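/- Work over $\mathbb{C}$. Let $n,k,s$ be non-negative integers with $k\le n$, and let $\mathbf d=(d_1,\dots,d_s)$ with all $d_i\ge 2$ and $\mathbf d\neq(2)$ (that is, not a single quadric). Put $$\delta(n,\mathbf d,k)=(k+1)(n-k)-\sum_{i=1}^s\binom{d_i+k}{k},$$ and suppose that $\delta(n,\mathbf d,k)<0$. Let $\Lambda'\subseteq\mathbb{P}^n$ be a $k$-dimensional linear subspace (an arbitrary one, so in particular a generic one), and let $S_{\Lambda'}(\mathbf d)$ be the vector space of all $s$-tuples $\mathbf f=(f_1,\dots,f_s)$, where $f_i$ is a form of degree $d_i$ in $n+1$ variables (or zero), such that $\Lambda'\subseteq V(\mathbf f)=\{f_1=\dots=f_s=0\}\subseteq\mathbb P^n$. Then for a generic $\mathbf f\in S_{\Lambda'}(\mathbf d)$ the Fano scheme $F_k(V(\mathbf f))$, i.e. the subscheme of the Grassmannian $\operatorname{Gr}(k,n)$ parametrizing the $k$-planes contained in $V(\mathbf f)$, is the single reduced point $[\Lambda']$. Here "generic" means: there is a homogeneous polynomial $Q$ in the coefficients of $\mathbf f$ that is not identically zero on $S_{\Lambda'}(\mathbf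 d)$ such that the assertion holds for all $\mathbf f\in S_{\Lambda'}(\mathbf d)$ with $Q(\mathbf f)\neq0$. The equality $F_k(V(\mathbf f))=[\Lambda']$ is one of subschemes of $\operatorname{Gr}(k,n)$: for every commutative $\mathbb C$-algebra $R$, the only $R$-valued point of $F_k(V(\mathbf f))$ is the constant point $\Lambda'\otimes_{\mathbb C}R$. -/

import Mathlib

universe u

open MvPolynomial

/-- The projective `k`-planes in `ℙⁿ` over `ℂ`, that is, the closed points of `Gr(k,n)`, viewed as
the linear subspaces of dimension `k + 1` in `ℂⁿ⁺¹`. -/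
def IsPlane {n : ℕ} (k : ℕ) (L : Submodule ℂ (Fin (n + 1) → ℂ)) : Prop :=
  Module.finrank ℂ L = k + 1

/-- The expected dimension
`δ(n, d, k) = (k+1)(n-k) - ∑ i, binom (d i + k) k`, as an integer. -/
def expectedDim {s : ℕ} (n : ℕ) (d : Fin s → ℕ) (k : ℕ) : ℤ :=
  ((k : ℤ) + 1) * ((n : ℤ) - (k : ℤ)) - ∑ i, ((d i + k).choose k : ℤ)

/-- The vector space of `s`-tuples `f` of forms in `n + 1` variables, the `i`-th one homogeneous of
degree `d i` (or zero), such that all `f i` vanish on the linear subspace `L`, i.e. the projective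
space of `L` is contained in `V(f)`. -/
def formsThrough {n s : ℕ} (d : Fin s → ℕ) (L : Submodule ℂ (Fin (n + 1) → ℂ)) :
    Submodule ℂ (Fin s → MvPolynomial (Fin (n + 1)) ℂ) where
  carrier := {f | (∀ i, (f i).IsHomogeneous (d i)) ∧ ∀ i, ∀ x ∈ L, eval x (f i) = 0}
  add_mem' := by
    rintro f g ⟨hf, hf'⟩ ⟨hg, hg'⟩
    refine ⟨fun i => (hf i).add (hg i), fun i x hx => ?_⟩
    simp [hf' i x hx, hg' i x hx]
  zero_mem' := ⟨fun i => isHomogeneous_zero _ _ _, fun i x _ => by simp⟩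
  smul_mem' := by
    rintro c f ⟨hf, hf'⟩
    refine ⟨fun i => (homogeneousSubmodule (Fin (n + 1)) ℂ (d i)).smul_mem c (hf i),
      fun i x hx => ?_⟩
    simp [hf' i x hx]

/-- The value at a tuple `f` of polynomials of a polynomial `Q` in the coefficients. The variable
`(i, m)` of `Q` stands for the coefficient of the monomial with exponent `m` in `f i`. -/
noncomputable def evalCoeffs {n s : ℕ} (Q : MvPolynomial (Fin s × (Fin (n + 1) →₀ ℕ)) ℂ)
    (f : Fin s → MvPolynomial (Fin (n + 1)) ℂ) : ℂ :=
  eval (fun p : Fin s × (Fin (n + 1) →₀ ℕ) => coeff p.2 (f p.1)) Q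

/-- `P` holds for the generic member `[f]` of the projective space of the linear system `S`: it
holds on a non-empty basic Zariski-open subset `{Q ≠ 0}`, where `Q` is a homogeneous polynomial in
the coefficients of `f`. (Such sets form a basis of the Zariski topology, and projective spaces are
irreducible, so this is the same as holding on a dense open subset.) -/
def HoldsGenerically {n s : ℕ} (S : Submodule ℂ (Fin s → MvPolynomial (Fin (n + 1)) ℂ))
    (P : (Fin s → MvPolynomial (Fin (n + 1)) ℂ) → Prop) : Prop :=
  ∃ (e : ℕ) (Q : MvPolynomial (Fin s × (Fin (n + 1) →₀ ℕ)) ℂ), Q.IsHomogeneous e ∧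
    (∃ f ∈ S, evalCoeffs Q f ≠ 0) ∧ ∀ f ∈ S, evalCoeffs Q f ≠ 0 → P f

/-- The set of `R`-valued points of the Fano scheme `F_k(V(f))`, for a `ℂ`-algebra `R`.
An `R`-valued point of `Gr(k,n)` is a submodule `M` of `Rⁿ⁺¹` whose quotient is locally free of rank
`n - k = (n + 1) - (k + 1)`; it lies in the Fano scheme iff every `f i` vanishes identically on `M`.
(As `ℂ` is infinite, a polynomial map over a `ℂ`-algebra that takes only the value zero on the
locally free module `M` is the zero polynomial in any local frame of `M`, so vanishing at all
elements of `M` is the usual scheme-theoretic condition.) -/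
def fanoPoints {n s : ℕ} (k : ℕ) (f : Fin s → MvPolynomial (Fin (n + 1)) ℂ)
    (R : Type u) [CommRing R] [Algebra ℂ R] :
    Set (Module.Grassmannian R (Fin (n + 1) → R) (n - k)) :=
  {M | ∀ i, ∀ x ∈ M.toSubmodule, aeval x (f i) = 0}

/-- The extension of scalars of a linear subspace `L ⊆ ℂⁿ⁺¹` to a submodule of `Rⁿ⁺¹`: the constant
`R`-valued point `[L]` of the Grassmannian. -/
def extendScalars {n : ℕ} (L : Submodule ℂ (Fin (n + 1) → ℂ))
    (R : Type u) [CommRing R] [Algebra ℂ R] : Submodule R (Fin (n + 1) → R) :=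
  Submodule.span R ((fun (x : Fin (n + 1) → ℂ) (j : Fin (n + 1)) => algebraMap ℂ R (x j)) ''
    (L : Set (Fin (n + 1) → ℂ)))

/-- `F_k(V(f)) = [L]` as subschemes of `Gr(k,n)`: the Fano scheme is the reduced closed point `[L]`.
Both sides are given by their functors of points: for each `ℂ`-algebra `R`, the only `R`-valued
point of the Fano scheme is the constant one, `L ⊗ R` (which, in particular, is such a point). -/
def FanoSchemeEqPoint {n s : ℕ} (k : ℕ) (f : Fin s → MvPolynomial (Fin (n + 1)) ℂ)
    (L : Submodule ℂ (Fin (n + 1) → ℂ)) : Prop :=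
  ∀ (R : Type u) [CommRing R] [Algebra ℂ R],
    Module.Grassmannian.toSubmodule '' fanoPoints k f R = {extendScalars L R}

/-! The proof is two dimension counts followed by an infinitesimal argument. A plane Λ ≠ L meets `L`
in a subspace of some dimension q < k+1; put t = k+1-q. Such planes form a family of dimension tq +
t(n-k). Restricting tuples in `formsThrough d L` to Λ yields every form on Λ that vanishes on Λ ∩ L,
so containing Λ imposes ∑ [mc(k+1, dᵢ) - mc(q, dᵢ)] independent conditions, where mc is
`Nat.multichoose`. The same two numbers occur for a tangent vector L → ℂⁿ⁺¹/L of rank t: choose its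
kernel and its values, and note that the derivatives along it yield every form on `L` that vanishes
on the kernel. In both cases `sum_multichoose_sub_gt` says that conditions outnumber parameters.
This is where δ < 0 and the exclusion of a single quadric enter.

"More conditions than parameters, hence not generic" is made effective by elimination:
`exists_homogeneous_vanishing` finds a nonzero homogeneous polynomial vanishing on all the kernels
in the family, and `holdsGenerically_exists_map_ne_zero` turns this into a statement about generic
tuples. The families become affine spaces through echelon forms, of which there are finitely many
types. This gives `holdsGenerically_unique_plane` and `holdsGenerically_unique_tangent`.

It remains to see that a Fano scheme with only one complex point and no tangent vectors there is a
reduced point. In a chart, the Nullstellensatz makes any R-point a nilpotent perturbation of `L`;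
the missing tangent vectors give N ≤ N² for the ideal N of the perturbation, so N = 0
(`graphSubmodule_eq_extendScalars`). Over a local ring every point lies in a chart, and
`fanoSchemeEqPoint_of_forall` globalizes by localization. -/

/-! ### The numerical inequality. -/

theorem Nat.mul_multichoose_eq (x e : ℕ) :
    (e + 2) * x.multichoose (e + 2) = x * (x + e + 1).choose (e + 1) := by
  rw [Nat.multichoose_eq]
  have h := Nat.choose_succ_right_eq (x + e + 1) (e + 1)
  have h1 : x + e + 1 - (e + 1) = x := by omega
  rw [h1] at h
  have h2 : x + (e + 2) - 1 = x + e + 1 := by omega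
  rw [h2]
  linarith

/-- Each Pascal step adds at least C(e+2, e) = (e+2)(e+1)/2, which is at least e+2 because e ≥ 1. -/
theorem Nat.add_mul_le_choose {q : ℕ} (t e : ℕ) (hq : 1 ≤ q) (he : 1 ≤ e) :
    (q + e + 1).choose (e + 1) + t * (e + 2) ≤ (q + t + e + 1).choose (e + 1) := by
  induction t with
  | zero => simp
  | succ t ih =>
    have h1 : q + (t + 1) + e + 1 = (q + t + e + 1) + 1 := by ring
    rw [h1, Nat.choose_succ_succ (q + t + e + 1)]
    have h2 : (e + 2).choose e ≤ (q + t + e + 1).choose e := Nat.choose_le_choose e (by omega)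
    have h3 : (e + 2).choose e = (e + 2).choose 2 := by
      rw [← Nat.choose_symm_add]
    have h4 : e + 2 ≤ (e + 2).choose 2 := by
      rw [Nat.choose_two_right, Nat.le_div_iff_mul_le (by norm_num)]
      have : e + 2 - 1 = e + 1 := by omega
      rw [this]
      nlinarith
    have h5 : (q + t + e + 1).choose e.succ = (q + t + e + 1).choose (e + 1) := rfl
    rw [h5]
    linarith

/-- Cleared of denominators: x ↦ mc(x, d)/x grows by at least t from q to q+t. For d = 2 this
quotient is (x+1)/2 and grows by t/2 only, whence the factor 2 in the next lemma. -/
theorem Nat.mul_multichoose_add_le {q t d : ℕ} (hd : 3 ≤ d) :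
    (q + t) * q * t + (q + t) * q.multichoose d ≤ q * (q + t).multichoose d := by
  obtain ⟨e, rfl⟩ : ∃ e, d = e + 2 := ⟨d - 2, by omega⟩
  rcases Nat.eq_zero_or_pos q with rfl | hq
  · simp
  have h1 := Nat.mul_multichoose_eq q e
  have h2 := Nat.mul_multichoose_eq (q + t) e
  have h3 := Nat.add_mul_le_choose t e hq (by omega)
  refine Nat.le_of_mul_le_mul_left ?_ (show 0 < e + 2 by omega)
  calc (e + 2) * ((q + t) * q * t + (q + t) * q.multichoose (e + 2))
      = (q + t) * q * (t * (e + 2)) + (q + t) * ((e + 2) * q.multichoose (e + 2)) := by ring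
    _ = (q + t) * q * ((q + e + 1).choose (e + 1) + t * (e + 2)) := by rw [h1]; ring
    _ ≤ (q + t) * q * (q + t + e + 1).choose (e + 1) := Nat.mul_le_mul_left _ h3
    _ = q * ((q + t) * (q + t + e + 1).choose (e + 1)) := by ring
    _ = (e + 2) * (q * (q + t).multichoose (e + 2)) := by rw [← h2]; ring

theorem Nat.mul_multichoose_add_le_two_mul {q t d : ℕ} (hd : 2 ≤ d) :
    (q + t) * q * t + 2 * ((q + t) * q.multichoose d) ≤ 2 * (q * (q + t).multichoose d) := by
  rcases hd.eq_or_lt with rfl | hd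
  · have h1 := Nat.mul_multichoose_eq q 0
    have h2 := Nat.mul_multichoose_eq (q + t) 0
    simp only [zero_add, add_zero, Nat.choose_one_right] at h1 h2
    nlinarith
  · have := Nat.mul_multichoose_add_le (q := q) (t := t) hd
    have : 0 ≤ (q + t) * q * t := Nat.zero_le _
    omega

theorem sum_multichoose_sub_gt {s : ℕ} (d : Fin s → ℕ) (hd : ∀ i, 2 ≤ d i)
    (hd2 : ¬ (s = 1 ∧ ∀ i, d i = 2)) {q t w : ℕ} (ht : 0 < t)
    (h : (q + t) * w < ∑ i, (q + t).multichoose (d i)) :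
    t * q + t * w + ∑ i, q.multichoose (d i) < ∑ i, (q + t).multichoose (d i) := by
  have key : (q + t) * q * t + (q + t) * ∑ i, q.multichoose (d i) ≤
      q * ∑ i, (q + t).multichoose (d i) := by
    rcases Nat.lt_or_ge s 2 with hs | hs
    · interval_cases s
      · simp at h
      · have h3 : 3 ≤ d 0 := by
          by_contra h3
          refine hd2 ⟨rfl, fun i => ?_⟩
          rw [Subsingleton.elim i 0]
          have := hd 0
          omega
        simpa using Nat.mul_multichoose_add_le (q := q) (t := t) h3
    · have h1 := Finset.sum_le_sum fun i (_ : i ∈ Finset.univ) =>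
        Nat.mul_multichoose_add_le_two_mul (q := q) (t := t) (hd i)
      rw [Finset.sum_add_distrib, Finset.sum_const, Finset.card_univ, Fintype.card_fin,
        smul_eq_mul, ← Finset.mul_sum, ← Finset.mul_sum, ← Finset.mul_sum, ← Finset.mul_sum] at h1
      have h2 : 2 * ((q + t) * q * t) ≤ s * ((q + t) * q * t) := Nat.mul_le_mul_right _ hs
      omega
  -- With S and S' the sums at q+t and q, `key` gives (q+t)(S - S') ≥ tS + (q+t)qt, and `h` bounds
  -- tS below by t(q+t)w.
  refine Nat.lt_of_mul_lt_mul_left (a := q + t) ?_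
  have h1 : t * ((q + t) * w) < t * ∑ i, (q + t).multichoose (d i) :=
    Nat.mul_lt_mul_of_pos_left h ht
  nlinarith

/-! ### Elimination for kernels of matrices of polynomials. -/

theorem Matrix.exists_submatrix_det_ne_zero {r ν K : Type*} [Fintype r] [DecidableEq r] [Fintype ν]
    [Field K] (M : Matrix r ν K) (hM : ∀ v, ∃ x, M.mulVec x = v) :
    ∃ J : r ↪ ν, (M.submatrix id J).det ≠ 0 := by
  have hspan : Submodule.span K (Set.range M.col) = ⊤ := by
    rw [← Matrix.range_mulVecLin, LinearMap.range_eq_top]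
    exact hM
  obtain ⟨κ, a, ha, hsp, hli⟩ := exists_linearIndependent' K M.col
  rw [hspan] at hsp
  let b := Module.Basis.mk hli hsp.ge
  have e : r ≃ κ := (Pi.basisFun K r).indexEquiv b
  refine ⟨e.toEmbedding.trans ⟨a, ha⟩, ?_⟩
  rw [← Matrix.det_transpose, ← isUnit_iff_ne_zero, ← Matrix.isUnit_iff_isUnit_det,
    ← Matrix.linearIndependent_rows_iff_isUnit]
  exact hli.comp e e.injective

theorem exists_ne_zero_aeval_eq_zero {ν τ : Type*} [Fintype ν] [Fintype τ]
    (P : ν → MvPolynomial τ ℂ) (h : Fintype.card τ < Fintype.card ν) :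
    ∃ Q : MvPolynomial ν ℂ, Q ≠ 0 ∧ aeval P Q = 0 := by
  by_contra! hQ
  have hP : AlgebraicIndependent ℂ P := by
    rw [algebraicIndependent_iff]
    intro p hp
    by_contra hne
    exact hQ p hne hp
  have := hP.lift_cardinalMk_le_trdeg
  rw [MvPolynomial.trdeg_of_isDomain] at this
  simp at this
  omega

theorem MvPolynomial.IsHomogeneous.aeval_smul {τ R : Type*} [CommRing R] [Algebra ℂ R]
    {g : MvPolynomial τ ℂ} {e : ℕ} (hg : g.IsHomogeneous e) (c : R) (x : τ → R) :
    MvPolynomial.aeval (c • x) g = c ^ e * MvPolynomial.aeval x g := by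
  rw [aeval_def, aeval_def, eval₂_eq, eval₂_eq, Finset.mul_sum]
  refine Finset.sum_congr rfl fun m hm => ?_
  have hdeg : ∑ i ∈ m.support, m i = e := by
    have := hg.degree_eq_sum_deg_support hm
    rw [this]
  simp only [Pi.smul_apply, smul_eq_mul, mul_pow, Finset.prod_mul_distrib, Finset.prod_pow_eq_pow_sum,
    hdeg]
  ring

theorem MvPolynomial.IsHomogeneous.eval_smul {τ : Type*}
    {g : MvPolynomial τ ℂ} {e : ℕ} (hg : g.IsHomogeneous e) (c : ℂ) (x : τ → ℂ) :
    eval (c • x) g = c ^ e * eval x g := by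
  simpa [coe_aeval_eq_eval] using hg.aeval_smul c x

/-- Along the line through the origin and `x`, the values of the homogeneous components are the
coefficients of a polynomial in c that vanishes identically. -/
theorem eval_homogeneousComponent_eq_zero {ν : Type*} (Q : MvPolynomial ν ℂ) (x : ν → ℂ)
    (h : ∀ c : ℂ, eval (c • x) Q = 0) (e : ℕ) : eval x (homogeneousComponent e Q) = 0 := by
  have hsum : ∀ c : ℂ, eval (c • x) Q =
      ∑ i ∈ Finset.range (Q.totalDegree + 1), c ^ i * eval x (homogeneousComponent i Q) := by
    intro c
    conv_lhs => rw [← sum_homogeneousComponent Q]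
    rw [map_sum]
    refine Finset.sum_congr rfl fun i _ => ?_
    exact (homogeneousComponent_isHomogeneous i Q).eval_smul c x
  let p : Polynomial ℂ := ∑ i ∈ Finset.range (Q.totalDegree + 1),
    Polynomial.C (eval x (homogeneousComponent i Q)) * Polynomial.X ^ i
  have hp : p = 0 := by
    refine Polynomial.funext fun c => ?_
    simp only [p, Polynomial.eval_finsetSum, Polynomial.eval_mul, Polynomial.eval_C,
      Polynomial.eval_pow, Polynomial.eval_X, Polynomial.eval_zero]
    rw [← h c, hsum c]
    exact Finset.sum_congr rfl fun i _ => mul_comm _ _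
  rcases Nat.lt_or_ge Q.totalDegree e with he | he
  · rw [homogeneousComponent_eq_zero _ _ he, map_zero]
  · have := congrArg (fun p => Polynomial.coeff p e) hp
    simpa [p, Polynomial.finsetSum_coeff, Polynomial.coeff_C_mul, Polynomial.coeff_X_pow,
      Nat.lt_succ_iff, he, Finset.sum_ite_eq] using this

/-- Where the minor on the columns `J` is nonzero, Cramer's rule recovers a kernel vector from `u`
and its coordinates outside `J`. These are fewer than |ν| parameters, so the coordinates satisfy an
algebraic relation. -/
theorem exists_homogeneous_vanishing_of_minor {σ r ν : Type*} [Fintype σ] [Fintype r]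
    [DecidableEq r] [Fintype ν] (M : Matrix r ν (MvPolynomial σ ℂ)) (J : r ↪ ν)
    (hc : Fintype.card σ < Fintype.card r) :
    ∃ (e : ℕ) (Q : MvPolynomial ν ℂ), Q.IsHomogeneous e ∧ Q ≠ 0 ∧
      ∀ (u : σ → ℂ) (x : ν → ℂ), (M.map (eval u)).mulVec x = 0 →
        ((M.map (eval u)).submatrix id J).det ≠ 0 → eval x Q = 0 := by
  classical
  let τ := {j : ν // j ∉ Set.range J}
  let G : Matrix r r (MvPolynomial σ ℂ) := M.submatrix id J
  let H : Matrix r τ (MvPolynomial σ ℂ) := M.submatrix id Subtype.val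
  -- The coordinates of det(G)·x as polynomials in `u` and the free coordinates; the factor det(G)
  -- avoids denominators.
  let P : ν → MvPolynomial (σ ⊕ τ) ℂ := fun j =>
    if h : ∃ i, J i = j then
      -∑ t, rename Sum.inl ((G.adjugate * H) h.choose t) * X (Sum.inr t)
    else rename Sum.inl G.det * X (Sum.inr ⟨j, h⟩)
  have hcard : Fintype.card (σ ⊕ τ) < Fintype.card ν := by
    have h1 : Fintype.card τ = Fintype.card ν - Fintype.card r := by
      have : Fintype.card τ = Fintype.card ↥((Set.range J)ᶜ : Set ν) := Fintype.card_congr (Equiv.refl _)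
      rw [this, Fintype.card_compl_set, Set.card_range_of_injective J.injective]
    have h2 : Fintype.card r ≤ Fintype.card ν := Fintype.card_le_of_embedding J
    rw [Fintype.card_sum]
    omega
  have hP : ∀ (u : σ → ℂ) (x : ν → ℂ), (M.map (eval u)).mulVec x = 0 → ∀ j,
      eval (Sum.elim u fun t : τ => x t) (P j) = (G.map (eval u)).det * x j := by
    intro u x hx j
    have hren : ∀ p : MvPolynomial σ ℂ,
        eval (Sum.elim u fun t : τ => x t) (rename Sum.inl p) = eval u p := by
      intro p
      rw [eval_rename]
      rfl
    have hdet : (G.map (eval u)).det = eval u G.det := by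
      rw [RingHom.map_det]
      rfl
    by_cases h : ∃ i, J i = j
    · have h1 : P j = -∑ t, rename Sum.inl ((G.adjugate * H) h.choose t) * X (Sum.inr t) := by
        simp only [P, dif_pos h]
      have hadj : (G.adjugate * H).map (eval u) = (G.map (eval u)).adjugate * H.map (eval u) := by
        rw [Matrix.map_mul]
        congr 1
        exact RingHom.map_adjugate (eval u) G
      have hsplit : (G.map (eval u)).mulVec (fun i => x (J i)) +
          (H.map (eval u)).mulVec (fun t => x t) = 0 := by
        rw [← hx]
        funext i
        simp only [Pi.add_apply, Matrix.mulVec, dotProduct]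
        rw [← Fintype.sum_subtype_add_sum_subtype (fun j => j ∈ Set.range J)
          (fun j => (M.map (eval u)) i j * x j)]
        refine congrArg₂ (· + ·) ?_ rfl
        convert Fintype.sum_equiv (Equiv.ofInjective J J.injective)
          (fun i' => (M.map (eval u)) i (J i') * x (J i'))
          (fun p : {j // j ∈ Set.range J} => (M.map (eval u)) i p * x p) (fun _ => rfl)
        rfl
      have h2 := congrArg ((G.map (eval u)).adjugate.mulVec) hsplit
      rw [Matrix.mulVec_add, Matrix.mulVec_zero, Matrix.mulVec_mulVec, Matrix.mulVec_mulVec,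
        Matrix.adjugate_mul, Matrix.smul_mulVec, Matrix.one_mulVec, ← hadj] at h2
      have h3 := congrFun h2 h.choose
      simp only [Pi.add_apply, Pi.smul_apply, smul_eq_mul, Pi.zero_apply, h.choose_spec] at h3
      rw [h1, eq_comm, ← sub_eq_zero, ← h3]
      simp [hren, Matrix.mulVec, dotProduct]
    · have h1 : P j = rename Sum.inl G.det * X (Sum.inr ⟨j, h⟩) := by
        simp only [P, dif_neg h]
      rw [h1, map_mul, hren, eval_X, hdet]
      rfl
  obtain ⟨Q, hQ0, hQ⟩ := exists_ne_zero_aeval_eq_zero P hcard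
  obtain ⟨e, he⟩ : ∃ e, homogeneousComponent e Q ≠ 0 := by
    by_contra! h
    exact hQ0 (by rw [← sum_homogeneousComponent Q]; exact Finset.sum_eq_zero fun i _ => h i)
  refine ⟨e, _, homogeneousComponent_isHomogeneous e Q, he, fun u x hx hdet => ?_⟩
  refine eval_homogeneousComponent_eq_zero Q x (fun c => ?_) e
  have hdet' : (G.map (eval u)).det ≠ 0 := hdet
  -- The kernel is stable under scaling; this multiple cancels the factor det(G), so that `P` takes
  -- the value c·x.
  have h1 := hP u ((c / (G.map (eval u)).det) • x) (by rw [Matrix.mulVec_smul, hx, smul_zero])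
  have h2 := congrArg (eval (Sum.elim u fun t : τ => ((c / (G.map (eval u)).det) • x) t)) hQ
  rw [map_zero, ← coe_aeval_eq_eval, AlgHom.coe_toRingHom, ← AlgHom.comp_apply, comp_aeval] at h2
  rw [← h2, ← coe_aeval_eq_eval, AlgHom.coe_toRingHom]
  congr 2
  funext j
  have h3 := h1 j
  rw [← coe_aeval_eq_eval] at h3
  refine Eq.trans ?_ h3.symm
  simp only [Pi.smul_apply, smul_eq_mul]
  field_simp

theorem finsetProd_homogeneous_vanishing {ν ι : Type*} [Fintype ι] (X : ι → Set (ν → ℂ))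
    (h : ∀ i, ∃ (e : ℕ) (Q : MvPolynomial ν ℂ), Q.IsHomogeneous e ∧ Q ≠ 0 ∧
      ∀ x ∈ X i, eval x Q = 0) :
    ∃ (e : ℕ) (Q : MvPolynomial ν ℂ), Q.IsHomogeneous e ∧ Q ≠ 0 ∧ ∀ i, ∀ x ∈ X i, eval x Q = 0 := by
  choose e Q hQ hQ0 hX using h
  refine ⟨∑ i, e i, ∏ i, Q i, IsHomogeneous.prod _ _ _ fun i _ => hQ i,
    Finset.prod_ne_zero_iff.2 fun i _ => hQ0 i, fun i x hx => ?_⟩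
  rw [map_prod]
  exact Finset.prod_eq_zero (Finset.mem_univ i) (hX i x hx)

/-- A set of vectors `x` each of which is killed by a specialization of full row rank of a matrix
of polynomials lies in a hypersurface, if there are more rows than variables. -/
theorem exists_homogeneous_vanishing {σ r ν : Type*} [Fintype σ] [Fintype r] [Fintype ν]
    (M : Matrix r ν (MvPolynomial σ ℂ)) (hc : Fintype.card σ < Fintype.card r) :
    ∃ (e : ℕ) (Q : MvPolynomial ν ℂ), Q.IsHomogeneous e ∧ Q ≠ 0 ∧
      ∀ (u : σ → ℂ) (x : ν → ℂ), (∀ v, ∃ z, (M.map (eval u)).mulVec z = v) →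
        (M.map (eval u)).mulVec x = 0 → eval x Q = 0 := by
  classical
  obtain ⟨e, Q, hQ, hQ0, h⟩ := finsetProd_homogeneous_vanishing
    (fun J : r ↪ ν => {x : ν → ℂ | ∃ u : σ → ℂ, (M.map (eval u)).mulVec x = 0 ∧
      ((M.map (eval u)).submatrix id J).det ≠ 0}) (fun J => by
      obtain ⟨e, Q, hQ, hQ0, h⟩ := exists_homogeneous_vanishing_of_minor M J hc
      exact ⟨e, Q, hQ, hQ0, fun x ⟨u, hu, hd⟩ => h u x hu hd⟩)
  refine ⟨e, Q, hQ, hQ0, fun u x hu hx => ?_⟩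
  obtain ⟨J, hJ⟩ := Matrix.exists_submatrix_det_ne_zero _ hu
  exact h J x ⟨u, hx, hJ⟩

/-! ### Calculus of generic properties. -/

theorem evalCoeffs_mul {n s : ℕ} (Q₁ Q₂ : MvPolynomial (Fin s × (Fin (n + 1) →₀ ℕ)) ℂ)
    (f : Fin s → MvPolynomial (Fin (n + 1)) ℂ) :
    evalCoeffs (Q₁ * Q₂) f = evalCoeffs Q₁ f * evalCoeffs Q₂ f := by
  simp [evalCoeffs]

theorem exists_polynomial_evalCoeffs_line {n s : ℕ}
    (Q : MvPolynomial (Fin s × (Fin (n + 1) →₀ ℕ)) ℂ)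
    (f g : Fin s → MvPolynomial (Fin (n + 1)) ℂ) :
    ∃ p : Polynomial ℂ, ∀ t : ℂ, p.eval t = evalCoeffs Q (f + t • g) := by
  refine ⟨aeval (fun p : Fin s × (Fin (n + 1) →₀ ℕ) =>
    Polynomial.C (coeff p.2 (f p.1)) + Polynomial.X * Polynomial.C (coeff p.2 (g p.1))) Q,
    fun t => ?_⟩
  rw [← Polynomial.coe_aeval_eq_eval, ← AlgHom.comp_apply, comp_aeval,
    evalCoeffs, ← coe_aeval_eq_eval, AlgHom.coe_toRingHom]
  congr 2
  funext p
  simp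
  ring

/-- Irreducibility of a vector space, by hand: on the line joining the two witnesses both
polynomials restrict to nonzero polynomials in one variable, and so does their product. -/
theorem HoldsGenerically.and {n s : ℕ} {S : Submodule ℂ (Fin s → MvPolynomial (Fin (n + 1)) ℂ)}
    {P₁ P₂ : (Fin s → MvPolynomial (Fin (n + 1)) ℂ) → Prop} (h₁ : HoldsGenerically S P₁)
    (h₂ : HoldsGenerically S P₂) : HoldsGenerically S fun f => P₁ f ∧ P₂ f := by
  obtain ⟨e₁, Q₁, hQ₁, ⟨f₁, hf₁, hne₁⟩, h₁⟩ := h₁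
  obtain ⟨e₂, Q₂, hQ₂, ⟨f₂, hf₂, hne₂⟩, h₂⟩ := h₂
  refine ⟨e₁ + e₂, Q₁ * Q₂, hQ₁.mul hQ₂, ?_, fun f hf hne => ?_⟩
  · obtain ⟨p₁, hp₁⟩ := exists_polynomial_evalCoeffs_line Q₁ f₁ (f₂ - f₁)
    obtain ⟨p₂, hp₂⟩ := exists_polynomial_evalCoeffs_line Q₂ f₁ (f₂ - f₁)
    have h10 : p₁ ≠ 0 := by
      rintro rfl
      have := hp₁ 0
      simp only [Polynomial.eval_zero, zero_smul, add_zero] at this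
      exact hne₁ this.symm
    have h20 : p₂ ≠ 0 := by
      rintro rfl
      have := hp₂ 1
      simp only [Polynomial.eval_zero, one_smul, add_sub_cancel] at this
      exact hne₂ this.symm
    obtain ⟨t, ht⟩ : ∃ t, (p₁ * p₂).eval t ≠ 0 := by
      by_contra! h
      exact mul_ne_zero h10 h20 (Polynomial.funext fun t => by rw [h t, Polynomial.eval_zero])
    refine ⟨f₁ + t • (f₂ - f₁), S.add_mem hf₁ (S.smul_mem _ (S.sub_mem hf₂ hf₁)), ?_⟩
    rwa [evalCoeffs_mul, ← hp₁, ← hp₂, ← Polynomial.eval_mul]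
  · rw [evalCoeffs_mul] at hne
    exact ⟨h₁ f hf (left_ne_zero_of_mul hne), h₂ f hf (right_ne_zero_of_mul hne)⟩

theorem HoldsGenerically.mono {n s : ℕ} {S : Submodule ℂ (Fin s → MvPolynomial (Fin (n + 1)) ℂ)}
    {P₁ P₂ : (Fin s → MvPolynomial (Fin (n + 1)) ℂ) → Prop} (h₁ : HoldsGenerically S P₁)
    (h : ∀ f ∈ S, P₁ f → P₂ f) : HoldsGenerically S P₂ := by
  obtain ⟨e, Q, hQ, hne, hP⟩ := h₁
  exact ⟨e, Q, hQ, hne, fun f hf hQf => h f hf (hP f hf hQf)⟩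

theorem holdsGenerically_true {n s : ℕ} (S : Submodule ℂ (Fin s → MvPolynomial (Fin (n + 1)) ℂ)) :
    HoldsGenerically S fun _ => True :=
  ⟨0, 1, isHomogeneous_one _ _, ⟨0, S.zero_mem, by simp [evalCoeffs]⟩, fun _ _ _ => trivial⟩

theorem HoldsGenerically.forall_finite {n s : ℕ}
    {S : Submodule ℂ (Fin s → MvPolynomial (Fin (n + 1)) ℂ)} {ι : Type*} [Finite ι]
    {P : ι → (Fin s → MvPolynomial (Fin (n + 1)) ℂ) → Prop} (h : ∀ i, HoldsGenerically S (P i)) :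
    HoldsGenerically S fun f => ∀ i, P i f := by
  classical
  have := Fintype.ofFinite ι
  suffices H : ∀ t : Finset ι, HoldsGenerically S fun f => ∀ i ∈ t, P i f from
    (H Finset.univ).mono fun f _ hf i => hf i (Finset.mem_univ i)
  intro t
  induction t using Finset.induction_on with
  | empty => exact (holdsGenerically_true S).mono fun f _ _ => by simp
  | insert a t _ ih => exact ((h a).and ih).mono fun f _ hf => by simpa using hf

/-! ### Coordinates on the linear system and the dimension count. -/

theorem formsThrough_eq_zero_of_coeff {n s : ℕ} {d : Fin s → ℕ}
    {L : Submodule ℂ (Fin (n + 1) → ℂ)} {f : Fin s → MvPolynomial (Fin (n + 1)) ℂ}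
    (hf : f ∈ formsThrough d L)
    (h : ∀ i, ∀ m ∈ Finset.univ.finsuppAntidiag (d i), coeff m (f i) = 0) : f = 0 := by
  funext i
  ext m
  by_cases hm : m.degree = d i
  · exact h i m (by simpa [Finset.mem_finsuppAntidiag, Finsupp.degree_eq_sum] using hm)
  · exact (hf.1 i).coeff_eq_zero hm

/-- The coefficients that may occur in a member of `formsThrough d L`. -/
noncomputable def coeffMap {n s : ℕ} (d : Fin s → ℕ) (L : Submodule ℂ (Fin (n + 1) → ℂ)) :
    formsThrough d L →ₗ[ℂ]
      ((Σ i : Fin s, (Finset.univ : Finset (Fin (n + 1))).finsuppAntidiag (d i)) → ℂ) where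
  toFun f p := coeff p.2.1 (f.1 p.1)
  map_add' f g := by ext p; simp
  map_smul' c f := by ext p; simp

theorem coeffMap_injective {n s : ℕ} (d : Fin s → ℕ) (L : Submodule ℂ (Fin (n + 1) → ℂ)) :
    Function.Injective (coeffMap d L) := by
  rw [injective_iff_map_eq_zero]
  intro f hf
  refine Subtype.ext (formsThrough_eq_zero_of_coeff f.2 fun i m hm => ?_)
  exact congrFun hf ⟨i, m, hm⟩

instance formsThrough_finite {n s : ℕ} (d : Fin s → ℕ) (L : Submodule ℂ (Fin (n + 1) → ℂ)) :
    Module.Finite ℂ (formsThrough d L) :=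
  Module.Finite.of_injective _ (coeffMap_injective d L)

theorem exists_linear_form_evalCoeffs {n s : ℕ} (d : Fin s → ℕ)
    (L : Submodule ℂ (Fin (n + 1) → ℂ)) (φ : formsThrough d L →ₗ[ℂ] ℂ) :
    ∃ ℓ : MvPolynomial (Fin s × (Fin (n + 1) →₀ ℕ)) ℂ, ℓ.IsHomogeneous 1 ∧
      ∀ f : formsThrough d L, evalCoeffs ℓ f.1 = φ f := by
  classical
  obtain ⟨g, hg⟩ := LinearMap.exists_leftInverse_of_injective (coeffMap d L)
    (LinearMap.ker_eq_bot.2 (coeffMap_injective d L))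
  refine ⟨∑ p, C (φ (g fun q => if p = q then 1 else 0)) * X (p.1, p.2.1),
    IsHomogeneous.sum _ _ _ fun p _ => isHomogeneous_C_mul_X _ _, fun f => ?_⟩
  have h1 : φ f = (φ.comp g) (coeffMap d L f) := by
    have h0 : g (coeffMap d L f) = f := LinearMap.congr_fun hg f
    rw [LinearMap.comp_apply, h0]
  rw [h1, LinearMap.pi_apply_eq_sum_univ]
  simp [evalCoeffs, coeffMap, mul_comm]

/-- The coordinates in a basis are linear forms in the coefficients, so substituting them keeps `Q`
homogeneous. -/
theorem holdsGenerically_of_basis {n s : ℕ} {d : Fin s → ℕ} {L : Submodule ℂ (Fin (n + 1) → ℂ)}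
    {ν : Type*} (b : Module.Basis ν ℂ (formsThrough d L)) {e : ℕ} {Q : MvPolynomial ν ℂ}
    (hQ : Q.IsHomogeneous e) (hQ0 : Q ≠ 0) {P : (Fin s → MvPolynomial (Fin (n + 1)) ℂ) → Prop}
    (h : ∀ f : formsThrough d L, eval (b.repr f) Q ≠ 0 → P f) :
    HoldsGenerically (formsThrough d L) P := by
  have : Finite ν := Module.Finite.finite_basis b
  choose ℓ hℓ hℓ' using fun j => exists_linear_form_evalCoeffs d L (b.coord j)
  have hev : ∀ f : formsThrough d L, evalCoeffs (aeval ℓ Q) f.1 = eval (b.repr f) Q := by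
    intro f
    rw [evalCoeffs, ← coe_aeval_eq_eval, AlgHom.coe_toRingHom, ← AlgHom.comp_apply, comp_aeval,
      ← coe_aeval_eq_eval, AlgHom.coe_toRingHom]
    congr 2
    funext j
    exact hℓ' j f
  refine ⟨1 * e, aeval ℓ Q, hQ.aeval ℓ hℓ, ?_, fun f hf hne => ?_⟩
  · obtain ⟨x, hx⟩ : ∃ x, eval x Q ≠ 0 := by
      by_contra! hx
      exact hQ0 (MvPolynomial.funext fun x => by rw [hx x, map_zero])
    refine ⟨(b.repr.symm (Finsupp.equivFunOnFinite.symm x)).1, Subtype.property _, ?_⟩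
    rw [hev, LinearEquiv.apply_symm_apply]
    simpa using hx
  · exact h ⟨f, hf⟩ (by rwa [← hev])

/-- Let `T` be a linear operator on forms whose coefficients depend polynomially on parameters `u`.
If the image of each `T u` contains all monomials of degree `d i` that involve a variable in `Z`,
and there are more such monomials than parameters, then no `T u` kills a generic tuple. -/
theorem holdsGenerically_exists_map_ne_zero {n s : ℕ} (d : Fin s → ℕ)
    (L : Submodule ℂ (Fin (n + 1) → ℂ)) {σ A : Type*} [Fintype σ] [Fintype A] [DecidableEq A]
    (Z : Finset A) (T : MvPolynomial (Fin (n + 1)) ℂ →ₗ[ℂ] MvPolynomial A (MvPolynomial σ ℂ))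
    (U : Set (σ → ℂ))
    (hT : ∀ u ∈ U, ∀ i, ∀ m : A →₀ ℕ, m.degree = d i → ∀ z ∈ Z, m z ≠ 0 →
      ∃ g : MvPolynomial (Fin (n + 1)) ℂ, g.IsHomogeneous (d i) ∧ (∀ x ∈ L, eval x g = 0) ∧
        map (eval u) (T g) = monomial m 1)
    (hcard : Fintype.card σ + ∑ i, (Zᶜ.card).multichoose (d i) <
      ∑ i, (Fintype.card A).multichoose (d i)) :
    HoldsGenerically (formsThrough d L) fun f => ∀ u ∈ U, ∃ i, map (eval u) (T (f i)) ≠ 0 := by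
  classical
  -- The conditions: monomials of degree `d i` that involve a variable in `Z`. The remaining
  -- coefficients of `T` are ignored.
  let r := Σ i : Fin s, ↥((Finset.univ : Finset A).finsuppAntidiag (d i) \
    Zᶜ.finsuppAntidiag (d i))
  have hr : Fintype.card σ < Fintype.card r := by
    have h1 : ∀ i, ((Finset.univ : Finset A).finsuppAntidiag (d i) \
        Zᶜ.finsuppAntidiag (d i)).card + (Zᶜ.card).multichoose (d i) =
        (Fintype.card A).multichoose (d i) := by
      intro i
      rw [← Finset.card_finsuppAntidiag_nat_eq_multichoose,
        Finset.card_sdiff_add_card_eq_card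
          (Finset.finsuppAntidiag_mono (Finset.subset_univ _) _),
        Finset.card_finsuppAntidiag_nat_eq_multichoose, Finset.card_univ]
    have h2 : Fintype.card r + ∑ i, (Zᶜ.card).multichoose (d i) =
        ∑ i, (Fintype.card A).multichoose (d i) := by
      simp only [r, Fintype.card_sigma, Fintype.card_coe]
      rw [← Finset.sum_add_distrib]
      exact Finset.sum_congr rfl fun i _ => h1 i
    omega
  let b := Module.finBasis ℂ (formsThrough d L)
  let M : Matrix r (Fin _) (MvPolynomial σ ℂ) :=
    Matrix.of fun p j => coeff p.2.1 (T ((b j).1 p.1))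
  have hM : ∀ (u : σ → ℂ) (f : formsThrough d L) (p : r),
      (M.map (eval u)).mulVec (b.repr f) p = coeff p.2.1 (map (eval u) (T (f.1 p.1))) := by
    intro u f p
    have hf : f.1 p.1 = ∑ j, b.repr f j • (b j).1 p.1 := by
      conv_lhs => rw [← b.sum_repr f]
      simp only [Submodule.coe_sum, Finset.sum_apply, Submodule.coe_smul, Pi.smul_apply]
    rw [hf]
    simp only [Matrix.mulVec, dotProduct, map_sum, map_smul, coeff_sum]
    refine Finset.sum_congr rfl fun j _ => ?_
    rw [coeff_map, coeff_smul, smul_eval, Matrix.map_apply, mul_comm]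
    rfl
  obtain ⟨e, Q, hQ, hQ0, hvan⟩ := exists_homogeneous_vanishing M hr
  refine holdsGenerically_of_basis b hQ hQ0 fun f hne u hu => ?_
  by_contra! hker
  refine hne (hvan u (b.repr f) ?_ ?_)
  -- Full row rank: by `hT` each monomial is the image of a form, placed in the single slot `i` of
  -- the tuple.
  · suffices H : ∀ p : r, ∃ z, (M.map (eval u)).mulVec z = Pi.single p 1 by
      choose z hz using H
      intro v
      refine ⟨∑ p, v p • z p, ?_⟩
      rw [← Matrix.mulVecLin_apply, map_sum]
      simp only [map_smul, Matrix.mulVecLin_apply, hz]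
      exact (pi_eq_sum_univ' v).symm
    rintro ⟨i, m, hm⟩
    rw [Finset.mem_sdiff, Finset.mem_finsuppAntidiag, Finset.mem_finsuppAntidiag] at hm
    obtain ⟨⟨hm1, -⟩, hm2⟩ := hm
    obtain ⟨z, hz, hmz⟩ : ∃ z ∈ Z, m z ≠ 0 := by
      by_contra! hZ
      have hsub : m.support ⊆ Zᶜ := by
        intro a ha
        rw [Finset.mem_compl]
        exact fun haZ => (Finsupp.mem_support_iff.1 ha) (hZ a haZ)
      refine hm2 ⟨?_, hsub⟩
      rw [← hm1]
      refine Finset.sum_subset (Finset.subset_univ _) fun a _ ha => ?_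
      by_contra h
      exact ha (hsub (Finsupp.mem_support_iff.2 h))
    obtain ⟨g, hg, hgL, hgT⟩ := hT u hu i m (by rw [← hm1, Finsupp.degree_eq_sum]) z hz hmz
    have hmem : Pi.single i g ∈ formsThrough d L := by
      refine ⟨fun j => ?_, fun j x hx => ?_⟩
      · rcases eq_or_ne j i with rfl | hji
        · simpa using hg
        · simpa [Pi.single_eq_of_ne hji] using isHomogeneous_zero _ _ _
      · rcases eq_or_ne j i with rfl | hji
        · simpa using hgL x hx
        · simp [Pi.single_eq_of_ne hji]
    refine ⟨b.repr ⟨_, hmem⟩, funext fun ⟨j, m', hm'⟩ => ?_⟩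
    rw [hM]
    rcases eq_or_ne j i with rfl | hji
    · simp only [Pi.single_eq_same, hgT, coeff_monomial]
      by_cases hmm : m = m'
      · subst hmm
        simp
      · rw [if_neg hmm, Pi.single_eq_of_ne]
        intro heq
        rw [Sigma.mk.injEq] at heq
        exact hmm (congrArg Subtype.val (eq_of_heq heq.2)).symm
    · rw [Pi.single_eq_of_ne (fun heq => hji (congrArg Sigma.fst heq))]
      simp [Pi.single_eq_of_ne hji]
  · funext p
    rw [hM, hker]
    simp

/-! ### Linear forms and restriction to a span. -/

/-- The linear form on `ℂᵐ` given by a functional. -/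
noncomputable def linForm {ι : Type*} [Fintype ι] [DecidableEq ι] (φ : Module.Dual ℂ (ι → ℂ)) :
    MvPolynomial ι ℂ :=
  ∑ j, C (φ (Pi.single j 1)) * X j

theorem linForm_isHomogeneous {ι : Type*} [Fintype ι] [DecidableEq ι]
    (φ : Module.Dual ℂ (ι → ℂ)) : (linForm φ).IsHomogeneous 1 :=
  IsHomogeneous.sum _ _ _ fun _ _ => isHomogeneous_C_mul_X _ _

theorem apply_eq_sum_single {ι : Type*} [Fintype ι] [DecidableEq ι]
    (φ : Module.Dual ℂ (ι → ℂ)) (x : ι → ℂ) : φ x = ∑ j, φ (Pi.single j 1) * x j := by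
  conv_lhs => rw [← Finset.univ_sum_single x]
  rw [map_sum]
  refine Finset.sum_congr rfl fun j _ => ?_
  rw [mul_comm, ← smul_eq_mul, ← map_smul, ← Pi.single_smul, smul_eq_mul, mul_one]

theorem eval_linForm {ι : Type*} [Fintype ι] [DecidableEq ι] (φ : Module.Dual ℂ (ι → ℂ))
    (x : ι → ℂ) : eval x (linForm φ) = φ x := by
  rw [apply_eq_sum_single, linForm]
  simp

theorem pderiv_linForm {ι : Type*} [Fintype ι] [DecidableEq ι] (φ : Module.Dual ℂ (ι → ℂ))
    (j : ι) : pderiv j (linForm φ) = C (φ (Pi.single j 1)) := by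
  rw [linForm, map_sum, Finset.sum_eq_single j]
  · simp
  · intro i _ hi
    simp [pderiv_X_of_ne hi]
  · simp

theorem linForm_prod_isHomogeneous {ι A : Type*} [Fintype ι] [DecidableEq ι] [Fintype A]
    (φ : A → Module.Dual ℂ (ι → ℂ)) (m : A →₀ ℕ) :
    (∏ a, linForm (φ a) ^ m a).IsHomogeneous m.degree := by
  rw [Finsupp.degree_eq_sum]
  refine IsHomogeneous.prod _ _ _ fun a _ => ?_
  simpa using (linForm_isHomogeneous (φ a)).pow (m a)

/-- The coordinates of the general linear combination of the vectors `W a`. -/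
noncomputable def lineSubst {ι A R : Type*} [Fintype A] [CommRing R] (W : A → ι → R) (j : ι) :
    MvPolynomial A R :=
  ∑ a, C (W a j) * X a

theorem eval_lineSubst {ι A R : Type*} [Fintype A] [CommRing R] (W : A → ι → R) (y : A → R)
    (j : ι) : eval y (lineSubst W j) = (∑ a, y a • W a) j := by
  simp [lineSubst, Finset.sum_apply, mul_comm]

theorem map_lineSubst {ι A R S : Type*} [Fintype A] [CommRing R] [CommRing S] (g : R →+* S)
    (W : A → ι → R) (j : ι) : map g (lineSubst W j) = lineSubst (fun a j => g (W a j)) j := by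
  simp [lineSubst]

theorem map_aeval_lineSubst {ι A σ : Type*} [Fintype A] (u : σ → ℂ)
    (W : A → ι → MvPolynomial σ ℂ) (g : MvPolynomial ι ℂ) :
    map (eval u) (aeval (lineSubst W) g) =
      aeval (lineSubst fun a j => eval u (W a j)) g := by
  have h := comp_aeval_apply (R := ℂ) (lineSubst W) (mapAlgHom (σ := A) (aeval (R := ℂ) u)) g
  have h2 : ∀ p : MvPolynomial A (MvPolynomial σ ℂ),
      mapAlgHom (σ := A) (aeval (R := ℂ) u) p = map (eval u) p := fun p => rfl
  simp only [h2, map_lineSubst] at h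
  exact h

theorem eval_aeval_lineSubst {ι A : Type*} [Fintype A] (W : A → ι → ℂ) (y : A → ℂ)
    (g : MvPolynomial ι ℂ) :
    eval y (aeval (lineSubst W) g) = eval (∑ a, y a • W a) g := by
  have h := comp_aeval_apply (R := ℂ) (lineSubst W) (aeval (R := ℂ) y) g
  have h2 : (fun j => (aeval (R := ℂ) y) (lineSubst W j)) = ∑ a, y a • W a := by
    funext j
    exact eval_lineSubst W y j
  rw [h2] at h
  exact h

theorem aeval_lineSubst_eq_zero {ι A : Type*} [Fintype A] (W : A → ι → ℂ)
    {Λ : Submodule ℂ (ι → ℂ)} (hW : ∀ a, W a ∈ Λ) {g : MvPolynomial ι ℂ}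
    (hg : ∀ x ∈ Λ, eval x g = 0) : aeval (lineSubst W) g = 0 := by
  refine MvPolynomial.funext fun y => ?_
  rw [eval_aeval_lineSubst, map_zero]
  exact hg _ (Λ.sum_mem fun a _ => Λ.smul_mem _ (hW a))

theorem aeval_lineSubst_linForm {ι A : Type*} [Fintype ι] [DecidableEq ι] [Fintype A]
    (W : A → ι → ℂ) (φ : Module.Dual ℂ (ι → ℂ)) :
    aeval (lineSubst W) (linForm φ) = ∑ a, C (φ (W a)) * X a := by
  refine MvPolynomial.funext fun y => ?_
  rw [eval_aeval_lineSubst, eval_linForm, map_sum, map_sum]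
  simp [mul_comm]

theorem aeval_lineSubst_prod {ι A : Type*} [Fintype ι] [DecidableEq ι] [Fintype A] [DecidableEq A]
    (W : A → ι → ℂ) (φ : A → Module.Dual ℂ (ι → ℂ))
    (h : ∀ a a', φ a (W a') = if a' = a then 1 else 0) (m : A →₀ ℕ) :
    aeval (lineSubst W) (∏ a, linForm (φ a) ^ m a) = monomial m 1 := by
  have h1 : ∀ a, aeval (lineSubst W) (linForm (φ a)) = X a := by
    intro a
    rw [aeval_lineSubst_linForm]
    simp [h]
  rw [map_prod]
  simp only [map_pow, h1]
  rw [monomial_eq, C_1, one_mul, Finsupp.prod_fintype _ _ fun _ => pow_zero _]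

/-! ### Dimension count for the other planes. -/

section Planes

variable {n k : ℕ} (e : Module.Basis (Fin (k + 1) ⊕ Fin (n - k)) ℂ (Fin (n + 1) → ℂ))
  (Z : Finset (Fin (k + 1))) (Y : Finset (Fin (n - k)))

/-- A basis of a plane in echelon form, whose pivots are the indices outside `Z` and `Y`. -/
noncomputable def echelonBasis (c : ↥Zᶜ → ↥Z → ℂ) (c' : ↥Yᶜ → ↥Z ⊕ ↥Y → ℂ) :
    ↥Zᶜ ⊕ ↥Yᶜ → Fin (n + 1) → ℂ
  | .inl p => e (.inl p) - ∑ z, c p z • e (.inl z)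
  | .inr t => e (.inr t) - ∑ i, c' t i • e (i.map Subtype.val Subtype.val)

/-- The operator is restriction to the plane with the given echelon basis, and the parameters are
`c` and `c'`. The vectors indexed by Zᶜ lie in the span of the `e (.inl a)`; every monomial
involving a variable from Yᶜ is the restriction of a form vanishing on `L`. -/
theorem holdsGenerically_echelonBasis {s : ℕ} {d : Fin s → ℕ} (hd : ∀ i, 2 ≤ d i)
    (hd2 : ¬ (s = 1 ∧ ∀ i, d i = 2))
    (hδ : (k + 1) * (n - k) < ∑ i, (k + 1).multichoose (d i))
    {L : Submodule ℂ (Fin (n + 1) → ℂ)} (hL : ∀ x ∈ L, ∀ b, e.repr x (.inr b) = 0)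
    (hZ : Z.Nonempty) (hcard : Z.card + Y.card = n - k) :
    HoldsGenerically (formsThrough d L) fun f => ∀ c c',
      ∃ i, aeval (lineSubst (echelonBasis e Z Y c c')) (f i) ≠ 0 := by
  let σ := (↥Zᶜ × ↥Z) ⊕ (↥Yᶜ × (↥Z ⊕ ↥Y))
  let W : ↥Zᶜ ⊕ ↥Yᶜ → Fin (n + 1) → MvPolynomial σ ℂ := fun a j => match a with
    | .inl p => C (e (.inl p) j) - ∑ z : ↥Z, X (.inl (p, z)) * C (e (.inl z) j)
    | .inr t => C (e (.inr t) j) -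
        ∑ i, X (.inr (t, i)) * C (e (i.map Subtype.val Subtype.val) j)
  have hW : ∀ u : σ → ℂ, (fun a j => eval u (W a j)) =
      echelonBasis e Z Y (fun p z => u (.inl (p, z))) (fun t i => u (.inr (t, i))) := by
    intro u
    funext a j
    rcases a with p | t <;> simp [W, echelonBasis, Finset.sum_apply]
  have key := holdsGenerically_exists_map_ne_zero d L (σ := σ) (A := ↥Zᶜ ⊕ ↥Yᶜ)
    ((Finset.univ : Finset ↥Yᶜ).map Function.Embedding.inr)
    (aeval (lineSubst W)).toLinearMap Set.univ ?_ ?_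
  · refine key.mono fun f _ hf c c' => ?_
    obtain ⟨i, hi⟩ := hf (Sum.elim (fun p => c p.1 p.2) (fun p => c' p.1 p.2)) trivial
    refine ⟨i, ?_⟩
    rw [AlgHom.toLinearMap_apply, map_aeval_lineSubst, hW] at hi
    exact hi
  · intro u _ i m hm a ha hma
    obtain ⟨t, -, rfl⟩ := Finset.mem_map.1 ha
    -- The pivot coordinates are dual to the echelon basis, whatever `c` and `c'` are; those from Yᶜ
    -- vanish on `L`.
    let φ : ↥Zᶜ ⊕ ↥Yᶜ → Module.Dual ℂ (Fin (n + 1) → ℂ) :=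
      fun a => e.coord (a.map Subtype.val Subtype.val)
    refine ⟨∏ a, linForm (φ a) ^ m a, hm ▸ linForm_prod_isHomogeneous φ m, fun x hx => ?_, ?_⟩
    · rw [map_prod]
      refine Finset.prod_eq_zero (Finset.mem_univ (Sum.inr t)) ?_
      rw [map_pow, eval_linForm]
      have : φ (Sum.inr t) x = 0 := hL x hx t
      rw [this]
      exact zero_pow hma
    · rw [AlgHom.toLinearMap_apply, map_aeval_lineSubst, hW]
      refine aeval_lineSubst_prod _ φ (fun a a' => ?_) m
      have hzp : ∀ (p : ↥Zᶜ) (z : ↥Z), (z : Fin (k + 1)) ≠ p := fun p z h =>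
        (Finset.mem_compl.1 p.2) (h ▸ z.2)
      have hyt : ∀ (t : ↥Yᶜ) (y : ↥Y), (y : Fin (n - k)) ≠ t := fun p z h =>
        (Finset.mem_compl.1 p.2) (h ▸ z.2)
      rcases a with p | t <;> rcases a' with p' | t' <;>
        simp [φ, echelonBasis, Finsupp.single_apply, hzp, hyt]
  · have h1 : (((Finset.univ : Finset ↥Yᶜ).map Function.Embedding.inr)ᶜ :
        Finset (↥Zᶜ ⊕ ↥Yᶜ)).card = Zᶜ.card := by
      rw [Finset.card_compl, Finset.card_map, Fintype.card_sum, Finset.card_univ,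
        Fintype.card_coe, Nat.add_sub_cancel]
    have hZk := Finset.card_le_univ Z
    have hYk := Finset.card_le_univ Y
    have h2 : Fintype.card (↥Zᶜ ⊕ ↥Yᶜ) = Zᶜ.card + Z.card := by
      rw [Fintype.card_sum, Fintype.card_coe, Fintype.card_coe, Finset.card_compl,
        Finset.card_compl]
      simp only [Fintype.card_fin] at *
      omega
    have h3 : Fintype.card σ = Z.card * Zᶜ.card + Z.card * (n - k) := by
      have hY : Yᶜ.card = Z.card := by
        rw [Finset.card_compl, Fintype.card_fin]
        omega
      simp only [σ, Fintype.card_sum, Fintype.card_prod, Fintype.card_coe, hcard, hY]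
      ring
    have h4 : Zᶜ.card + Z.card = k + 1 := by
      rw [Finset.card_compl, Nat.sub_add_cancel hZk, Fintype.card_fin]
    rw [h1, h2, h3]
    refine sum_multichoose_sub_gt d hd hd2 hZ.card_pos ?_
    rwa [h4]

end Planes

/-! ### Dimension count for tangent vectors. -/

section Tangent

variable {n k : ℕ} (e : Module.Basis (Fin (k + 1) ⊕ Fin (n - k)) ℂ (Fin (n + 1) → ℂ))
  (Z : Finset (Fin (k + 1)))

/-- A basis of `L` adapted to the kernel of a linear map on `L`. -/
noncomputable def kernelBasis (c : ↥Zᶜ → ↥Z → ℂ) (a : Fin (k + 1)) : Fin (n + 1) → ℂ :=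
  if h : a ∈ Z then e (.inl a) else
    e (.inl a) - ∑ z, c ⟨a, Finset.mem_compl.2 h⟩ z • e (.inl z)

/-- The values on `kernelBasis` of a linear map. -/
noncomputable def kernelValue (r : ↥Z → Fin (n - k) → ℂ) (a : Fin (k + 1)) : Fin (n + 1) → ℂ :=
  if h : a ∈ Z then ∑ b, r ⟨a, h⟩ b • e (.inr b) else 0

/-- The derivative of a form along `α`, in the direction of `β`. -/
noncomputable def dirDeriv {ι A R : Type*} [Fintype ι] [Fintype A] [CommRing R] [Algebra ℂ R]
    (α β : A → ι → R) : MvPolynomial ι ℂ →ₗ[ℂ] MvPolynomial A R :=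
  ∑ j, LinearMap.mulLeft ℂ (lineSubst β j) ∘ₗ (aeval (lineSubst α)).toLinearMap ∘ₗ
    (pderiv j).toLinearMap

theorem dirDeriv_apply {ι A R : Type*} [Fintype ι] [Fintype A] [CommRing R] [Algebra ℂ R]
    (α β : A → ι → R) (g : MvPolynomial ι ℂ) :
    dirDeriv α β g = ∑ j, lineSubst β j * aeval (lineSubst α) (pderiv j g) := by
  simp [dirDeriv]

theorem map_dirDeriv {ι A σ : Type*} [Fintype ι] [Fintype A] (u : σ → ℂ)
    (α β : A → ι → MvPolynomial σ ℂ) (g : MvPolynomial ι ℂ) :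
    map (eval u) (dirDeriv α β g) =
      dirDeriv (fun a j => eval u (α a j)) (fun a j => eval u (β a j)) g := by
  simp only [dirDeriv_apply, map_sum, map_mul, map_lineSubst, map_aeval_lineSubst]

/-- Leibniz' rule; the term that keeps φ undifferentiated dies because φ vanishes along α. -/
theorem dirDeriv_linForm_mul {ι A : Type*} [Fintype ι] [DecidableEq ι] [Fintype A]
    (α β : A → ι → ℂ) {φ : Module.Dual ℂ (ι → ℂ)} (hφ : ∀ a, φ (α a) = 0)
    (g : MvPolynomial ι ℂ) :
    dirDeriv α β (linForm φ * g) = (∑ a, C (φ (β a)) * X a) * aeval (lineSubst α) g := by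
  have h1 : aeval (lineSubst α) (linForm φ) = 0 := by
    rw [aeval_lineSubst_linForm]
    simp [hφ]
  rw [dirDeriv_apply]
  simp only [Derivation.leibniz, smul_eq_mul, map_add, map_mul, h1, zero_mul, zero_add,
    pderiv_linForm]
  rw [← aeval_lineSubst_linForm, linForm, map_sum, Finset.sum_mul]
  refine Finset.sum_congr rfl fun j _ => ?_
  simp only [map_mul, aeval_X, algHom_C, algebraMap_eq]
  ring

theorem LinearIndependent.exists_dual {ι V : Type*} [AddCommGroup V] [Module ℂ V] {v : ι → V}
    [DecidableEq ι] (hv : LinearIndependent ℂ v) (i : ι) :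
    ∃ φ : Module.Dual ℂ V, ∀ j, φ (v j) = if j = i then 1 else 0 := by
  obtain ⟨φ, hφ⟩ := LinearMap.exists_extend ((Finsupp.lapply i : (ι →₀ ℂ) →ₗ[ℂ] ℂ) ∘ₗ
    hv.repr)
  refine ⟨φ, fun j => ?_⟩
  have h := LinearMap.congr_fun hφ ⟨v j, Submodule.subset_span (Set.mem_range_self j)⟩
  have h2 : φ (v j) = (hv.repr ⟨v j, Submodule.subset_span (Set.mem_range_self j)⟩) i := h
  rw [h2, hv.repr_eq_single j _ rfl, Finsupp.single_apply]

/-- A map from `L` to a complement, of rank |Z|, is encoded by its kernel (`c`) and independent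
values (`r`). Independence is needed only for surjectivity onto the monomials involving a variable
in `Z`, and so it enters through the set of admissible parameters. -/
theorem holdsGenerically_dirDeriv {s : ℕ} {d : Fin s → ℕ} (hd : ∀ i, 2 ≤ d i)
    (hd2 : ¬ (s = 1 ∧ ∀ i, d i = 2))
    (hδ : (k + 1) * (n - k) < ∑ i, (k + 1).multichoose (d i))
    {L : Submodule ℂ (Fin (n + 1) → ℂ)} (hL : ∀ x ∈ L, ∀ b, e.repr x (.inr b) = 0)
    (hZ : Z.Nonempty) :
    HoldsGenerically (formsThrough d L) fun f => ∀ c r, LinearIndependent ℂ r →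
      ∃ i, dirDeriv (kernelBasis e Z c) (kernelValue e Z r) (f i) ≠ 0 := by
  let σ := (↥Zᶜ × ↥Z) ⊕ (↥Z × Fin (n - k))
  let α : Fin (k + 1) → Fin (n + 1) → MvPolynomial σ ℂ := fun a j =>
    if h : a ∈ Z then C (e (.inl a) j) else
      C (e (.inl a) j) - ∑ z : ↥Z, X (.inl (⟨a, Finset.mem_compl.2 h⟩, z)) * C (e (.inl z) j)
  let β : Fin (k + 1) → Fin (n + 1) → MvPolynomial σ ℂ := fun a j =>
    if h : a ∈ Z then ∑ b, X (.inr (⟨a, h⟩, b)) * C (e (.inr b) j) else 0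
  have hα : ∀ u : σ → ℂ, (fun a j => eval u (α a j)) =
      kernelBasis e Z (fun p z => u (.inl (p, z))) := by
    intro u
    funext a j
    by_cases h : a ∈ Z <;> simp [α, kernelBasis, h, Finset.sum_apply]
  have hβ : ∀ u : σ → ℂ, (fun a j => eval u (β a j)) =
      kernelValue e Z (fun z b => u (.inr (z, b))) := by
    intro u
    funext a j
    by_cases h : a ∈ Z <;> simp [β, kernelValue, h, Finset.sum_apply]
  have key := holdsGenerically_exists_map_ne_zero d L (σ := σ) (A := Fin (k + 1)) Z
    (dirDeriv α β) {u | LinearIndependent ℂ fun (z : ↥Z) (b : Fin (n - k)) => u (.inr (z, b))} ?_ ?_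
  · refine key.mono fun f _ hf c r hr => ?_
    obtain ⟨i, hi⟩ := hf (Sum.elim (fun p => c p.1 p.2) (fun p => r p.1 p.2)) hr
    refine ⟨i, ?_⟩
    rw [map_dirDeriv, hα, hβ] at hi
    exact hi
  · intro u hu i m hm z hz hmz
    -- ψ singles out the value at `z`. Then φ vanishes on `L`, and differentiating φ·g along the
    -- tangent vector gives the variable `z` times the restriction of g; the η a form the basis dual
    -- to `kernelBasis`.
    obtain ⟨ψ, hψ⟩ := LinearIndependent.exists_dual hu ⟨z, hz⟩
    let φ : Module.Dual ℂ (Fin (n + 1) → ℂ) := ψ ∘ₗ LinearMap.pi fun b => e.coord (.inr b)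
    let η : Fin (k + 1) → Module.Dual ℂ (Fin (n + 1) → ℂ) := fun a =>
      if h : a ∈ Z then e.coord (.inl a) +
        ∑ p : ↥Zᶜ, u (.inl (p, ⟨a, h⟩)) • e.coord (.inl p) else e.coord (.inl a)
    have hφL : ∀ x ∈ L, φ x = 0 := by
      intro x hx
      have : (fun b => e.coord (.inr b) x) = 0 := funext fun b => hL x hx b
      exact (congrArg ψ this).trans (map_zero ψ)
    obtain ⟨m', rfl⟩ : ∃ m', m = Finsupp.single z 1 + m' := by
      obtain ⟨m', hm'⟩ := le_iff_exists_add.1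
        (Finsupp.single_le_iff.2 (Nat.one_le_iff_ne_zero.2 hmz))
      exact ⟨m', hm'⟩
    refine ⟨linForm φ * ∏ a, linForm (η a) ^ m' a, ?_, fun x hx => ?_, ?_⟩
    · rw [← hm, map_add, Finsupp.degree_single]
      exact (linForm_isHomogeneous φ).mul (linForm_prod_isHomogeneous η m')
    · rw [map_mul, eval_linForm, hφL x hx, zero_mul]
    · have hφα : ∀ a, φ (kernelBasis e Z (fun p z => u (.inl (p, z))) a) = 0 := by
        intro a
        have : (fun b => e.coord (.inr b)
            (kernelBasis e Z (fun p z => u (.inl (p, z))) a)) = 0 := by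
          funext b
          by_cases h : a ∈ Z <;> simp [kernelBasis, h]
        exact (congrArg ψ this).trans (map_zero ψ)
      have hφβ : ∀ a, φ (kernelValue e Z (fun z b => u (.inr (z, b))) a) =
          if a = z then 1 else 0 := by
        intro a
        by_cases h : a ∈ Z
        · have h1 : (fun b => e.coord (.inr b)
              (kernelValue e Z (fun z b => u (.inr (z, b))) a)) =
              fun b => u (.inr (⟨a, h⟩, b)) := by
            funext b
            simp [kernelValue, h, Finsupp.single_apply]
          have h2 := hψ ⟨a, h⟩
          simp only [Subtype.mk.injEq] at h2
          exact (congrArg ψ h1).trans h2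
        · have : a ≠ z := fun h' => h (h' ▸ hz)
          simp [kernelValue, h, this]
      rw [map_dirDeriv, hα, hβ, dirDeriv_linForm_mul _ _ hφα, aeval_lineSubst_prod _ η]
      · simp only [hφβ]
        simp [X, monomial_mul]
      · intro a a'
        have hzp : ∀ (p : ↥Zᶜ), (p : Fin (k + 1)) ∉ Z := fun p => Finset.mem_compl.1 p.2
        by_cases h : a ∈ Z <;> by_cases h' : a' ∈ Z
        · have : ∀ p : ↥Zᶜ, a' ≠ p := fun p hp => hzp p (hp ▸ h')
          simp [η, kernelBasis, h, h', Finsupp.single_apply, this]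
        · have h1 : a' ≠ a := fun hp => h' (hp ▸ h)
          have h2 : ∀ p : ↥Zᶜ, a' = p ↔ p = ⟨a', Finset.mem_compl.2 h'⟩ := fun p =>
            ⟨fun hp => Subtype.ext hp.symm, fun hp => (congrArg Subtype.val hp).symm⟩
          have h3 : ∀ z : ↥Z, (z : Fin (k + 1)) = a ↔ z = ⟨a, h⟩ := fun z =>
            ⟨fun hz => Subtype.ext hz, fun hz => congrArg Subtype.val hz⟩
          have h4 : ∀ (z : ↥Z) (p : ↥Zᶜ), (z : Fin (k + 1)) ≠ p := fun z p hp =>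
            hzp p (hp ▸ z.2)
          simp [η, kernelBasis, h, h', Finsupp.single_apply, h1, h2, h3, h4]
        · have : a' ≠ a := fun hp => h (hp ▸ h')
          simp [η, kernelBasis, h, h', this]
        · have : ∀ z : ↥Z, (z : Fin (k + 1)) ≠ a := fun p hp => h (hp ▸ p.2)
          simp [η, kernelBasis, h, h', Finsupp.single_apply, this]
  · have hZk := Finset.card_le_univ Z
    have h3 : Fintype.card σ = Z.card * Zᶜ.card + Z.card * (n - k) := by
      simp only [σ, Fintype.card_sum, Fintype.card_prod, Fintype.card_coe, Fintype.card_fin]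
      ring
    have h4 : Zᶜ.card + Z.card = k + 1 := by
      rw [Finset.card_compl, Nat.sub_add_cancel hZk, Fintype.card_fin]
    have h5 := sum_multichoose_sub_gt d hd hd2 (q := Zᶜ.card) (t := Z.card) (w := n - k)
      hZ.card_pos (by rwa [h4])
    rw [h4] at h5
    rwa [Fintype.card_fin, h3]

end Tangent

/-! ### First-order Taylor expansion and extension of scalars. -/

theorem aeval_add_sub_mem_sq {ι R : Type*} [Fintype ι] [CommRing R] [Algebra ℂ R] (N : Ideal R)
    (v δ : ι → R) (hδ : ∀ j, δ j ∈ N) (g : MvPolynomial ι ℂ) :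
    aeval (v + δ) g - aeval v g - ∑ j, aeval v (pderiv j g) * δ j ∈ N ^ 2 := by
  classical
  induction g using MvPolynomial.induction_on with
  | C a => simp
  | add p q hp hq =>
    convert (N ^ 2).add_mem hp hq using 1
    simp only [map_add, add_mul, Finset.sum_add_distrib]
    ring
  | mul_X p i hp =>
    have h1 : ∑ j, aeval v (pderiv j p) * δ j ∈ N :=
      N.sum_mem fun j _ => N.mul_mem_left _ (hδ j)
    have h2 : δ i * ∑ j, aeval v (pderiv j p) * δ j ∈ N ^ 2 := by
      rw [pow_two]
      exact Ideal.mul_mem_mul (hδ i) h1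
    have h3 : ∑ j, aeval v (pderiv j (p * X i)) * δ j =
        v i * (∑ j, aeval v (pderiv j p) * δ j) + aeval v p * δ i := by
      have : ∀ j, aeval v (pderiv j (p * X i)) * δ j = v i * (aeval v (pderiv j p) * δ j) +
          if j = i then aeval v p * δ i else 0 := by
        intro j
        rw [Derivation.leibniz]
        by_cases hj : j = i
        · subst hj
          simp
          ring
        · simp [pderiv_X_of_ne (Ne.symm hj), hj]
          ring
      simp only [this, Finset.sum_add_distrib, ← Finset.mul_sum]
      simp
    rw [h3]
    convert (N ^ 2).add_mem ((N ^ 2).mul_mem_left (v i + δ i) hp) h2 using 1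
    simp only [map_mul, aeval_X, Pi.add_apply]
    ring

theorem aeval_eq_zero_of_mem_extendScalars {n : ℕ} {L : Submodule ℂ (Fin (n + 1) → ℂ)}
    {g : MvPolynomial (Fin (n + 1)) ℂ} (hg : ∀ x ∈ L, eval x g = 0) {R : Type u} [CommRing R]
    [Algebra ℂ R] {x : Fin (n + 1) → R} (hx : x ∈ extendScalars L R) : aeval x g = 0 := by
  obtain ⟨A, _, w, y, hw, rfl⟩ : ∃ (A : Type) (_ : Fintype A) (w : A → Fin (n + 1) → ℂ) (y : A → R),
      (∀ a, w a ∈ L) ∧ x = fun j => ∑ a, y a * algebraMap ℂ R (w a j) := by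
    let b := Module.finBasis ℂ L
    refine ⟨_, inferInstance, fun a => (b a : Fin (n + 1) → ℂ), ?_⟩
    suffices H : ∃ y : Fin _ → R, x = fun j => ∑ a, y a * algebraMap ℂ R ((b a).1 j) by
      obtain ⟨y, hy⟩ := H
      exact ⟨y, fun a => (b a).2, hy⟩
    refine Submodule.span_induction ?_ ?_ ?_ ?_ hx
    · rintro _ ⟨z, hz, rfl⟩
      refine ⟨fun a => algebraMap ℂ R (b.repr ⟨z, hz⟩ a), funext fun j => ?_⟩
      have h := congrArg (fun t : L => t.1 j) (b.sum_repr ⟨z, hz⟩)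
      simp only [Submodule.coe_sum, Finset.sum_apply, Submodule.coe_smul, Pi.smul_apply,
        smul_eq_mul] at h
      simp only [← map_mul, ← map_sum, h]
    · exact ⟨0, by funext j; simp⟩
    · rintro _ _ - - ⟨y, rfl⟩ ⟨y', rfl⟩
      exact ⟨y + y', by funext j; simp [add_mul, Finset.sum_add_distrib]⟩
    · rintro r _ - ⟨y, rfl⟩
      exact ⟨r • y, by funext j; simp [Finset.mul_sum, mul_assoc]⟩
  have h0 := aeval_lineSubst_eq_zero w hw hg
  have h1 := comp_aeval_apply (R := ℂ) (lineSubst w) (aeval (R := ℂ) y) g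
  rw [h0, map_zero] at h1
  rw [h1]
  congr 2
  funext j
  simp [lineSubst, mul_comm]

/-- The form vanishes at x + Xl over ℂ[X], and the sum is the coefficient of X in its Taylor
expansion. Hence only the class of a tangent direction modulo `L` matters. -/
theorem sum_pderiv_eq_zero_of_mem {n : ℕ} {L : Submodule ℂ (Fin (n + 1) → ℂ)}
    {g : MvPolynomial (Fin (n + 1)) ℂ} (hg : ∀ x ∈ L, eval x g = 0) {x l : Fin (n + 1) → ℂ}
    (hx : x ∈ L) (hl : l ∈ L) : ∑ j, eval x (pderiv j g) * l j = 0 := by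
  have hmem : ∀ z ∈ L, (fun j => Polynomial.C (z j)) ∈ extendScalars L (Polynomial ℂ) :=
    fun z hz => Submodule.subset_span ⟨z, hz, rfl⟩
  have hX : Polynomial.X ∈ Ideal.span {(Polynomial.X : Polynomial ℂ)} :=
    Ideal.mem_span_singleton_self _
  have h := aeval_add_sub_mem_sq (Ideal.span {(Polynomial.X : Polynomial ℂ)})
    (fun j => Polynomial.C (x j)) ((Polynomial.X : Polynomial ℂ) • fun j => Polynomial.C (l j))
    (fun j => Ideal.mul_mem_right _ _ hX) g
  rw [aeval_eq_zero_of_mem_extendScalars hg (hmem x hx), aeval_eq_zero_of_mem_extendScalars hg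
    (Submodule.add_mem _ (hmem x hx) (Submodule.smul_mem _ _ (hmem l hl)))] at h
  have h2 : ∀ p : MvPolynomial (Fin (n + 1)) ℂ,
      aeval (fun j => Polynomial.C (x j)) p = Polynomial.C (eval x p) := by
    intro p
    exact (comp_aeval_apply (R := ℂ) x (Algebra.ofId ℂ (Polynomial ℂ)) p).symm
  simp only [h2, sub_zero, zero_sub, neg_mem_iff, Ideal.span_singleton_pow,
    Ideal.mem_span_singleton] at h
  rw [show ∑ j, Polynomial.C (eval x (pderiv j g)) *
      ((Polynomial.X : Polynomial ℂ) • fun j => Polynomial.C (l j)) j =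
      Polynomial.C (∑ j, eval x (pderiv j g) * l j) * Polynomial.X ^ 1 by
    rw [map_sum, Finset.sum_mul]
    refine Finset.sum_congr rfl fun j _ => ?_
    simp only [Pi.smul_apply, smul_eq_mul, map_mul]
    ring, Polynomial.X_pow_dvd_iff] at h
  simpa using h 1 one_lt_two

/-! ### Generic uniqueness of the plane and absence of tangent vectors. -/

theorem exists_adapted_basis {n k : ℕ} {L : Submodule ℂ (Fin (n + 1) → ℂ)} (hL : IsPlane k L) :
    ∃ e : Module.Basis (Fin (k + 1) ⊕ Fin (n - k)) ℂ (Fin (n + 1) → ℂ),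
      L = Submodule.span ℂ (Set.range fun a => e (.inl a)) ∧
        ∀ x ∈ L, ∀ b, e.repr x (.inr b) = 0 := by
  obtain ⟨K, hK⟩ := Submodule.exists_isCompl L
  have hKr : Module.finrank ℂ K = n - k := by
    have := Submodule.finrank_add_eq_of_isCompl hK
    rw [hL, Module.finrank_fin_fun] at this
    omega
  let bL := Module.finBasisOfFinrankEq ℂ L hL
  let bK := Module.finBasisOfFinrankEq ℂ K hKr
  let e := (bL.prod bK).map (Submodule.prodEquivOfIsCompl L K hK)
  have he : ∀ a, e (.inl a) = bL a := by
    intro a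
    simp [e]
  have hspan : L = Submodule.span ℂ (Set.range fun a => e (.inl a)) := by
    have h1 : (fun a => e (.inl a)) = L.subtype ∘ bL := funext he
    rw [h1, Set.range_comp, ← Submodule.map_span, bL.span_eq, Submodule.map_top,
      Submodule.range_subtype]
  refine ⟨e, hspan, fun x hx b => ?_⟩
  have h2 : L ≤ LinearMap.ker (e.coord (.inr b)) := by
    rw [hspan, Submodule.span_le]
    rintro _ ⟨a, rfl⟩
    simp
  exact h2 hx

theorem exists_linearIndependent_finset {A V : Type*} [Fintype A] [AddCommGroup V] [Module ℂ V]
    (v : A → V) : ∃ (Z : Finset A) (c : A → ↥Z → ℂ), LinearIndependent ℂ (fun z : ↥Z => v z) ∧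
      ∀ a, v a = ∑ z, c a z • v z := by
  classical
  obtain ⟨b, -, -, hb, hli⟩ := exists_linearIndepOn_extension (K := ℂ) (v := v)
    (linearIndepOn_empty ℂ v) (Set.empty_subset Set.univ)
  have hZ : ∀ a, a ∈ b.toFinset ↔ a ∈ b := fun a => Set.mem_toFinset
  have hspan : ∀ a, v a ∈ Submodule.span ℂ (Set.range fun z : ↥b.toFinset => v z) := by
    intro a
    have h : Set.range (fun z : ↥b.toFinset => v z) = v '' b := by
      ext x
      simp
    rw [h]
    exact hb ⟨a, Set.mem_univ a, rfl⟩
  choose c hc using fun a => (Submodule.mem_span_range_iff_exists_fun ℂ).1 (hspan a)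
  exact ⟨b.toFinset, c, hli.comp (fun z : ↥b.toFinset => (⟨z, (hZ z).1 z.2⟩ : b))
    fun z z' h => Subtype.ext (congrArg (fun t : b => (t : A)) h), fun a => (hc a).symm⟩

/-- Work in the quotient by Λ: `Z` indexes a basis of the image of `L`, and `Y` completes it to a
basis of the whole quotient. Expressing the other images in these bases gives relations, that is,
vectors of Λ. If `Z` were empty, `L` would lie in Λ and equal it by dimension. -/
theorem exists_echelonBasis_mem {n k : ℕ}
    (e : Module.Basis (Fin (k + 1) ⊕ Fin (n - k)) ℂ (Fin (n + 1) → ℂ))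
    {L Λ : Submodule ℂ (Fin (n + 1) → ℂ)} (hL : IsPlane k L) (hΛ : IsPlane k Λ) (hne : Λ ≠ L)
    (heL : L = Submodule.span ℂ (Set.range fun a => e (.inl a))) :
    ∃ (Z : Finset (Fin (k + 1))) (Y : Finset (Fin (n - k))) (c : ↥Zᶜ → ↥Z → ℂ)
      (c' : ↥Yᶜ → ↥Z ⊕ ↥Y → ℂ), Z.Nonempty ∧ Z.card + Y.card = n - k ∧
        ∀ a, echelonBasis e Z Y c c' a ∈ Λ := by
  classical
  let q := fun i => Λ.mkQ (e i)
  obtain ⟨Z, c, hZ, hc⟩ := exists_linearIndependent_finset fun a => q (.inl a)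
  have hZon : LinearIndepOn ℂ q (Sum.inl '' (Z : Set (Fin (k + 1)))) :=
    LinearIndepOn.image_of_comp Sum.inl q hZ
  obtain ⟨b, hbt, hbZ, hspan, hli⟩ := exists_linearIndepOn_extension hZon
    (Set.subset_union_left (t := Set.range (Sum.inr : Fin (n - k) → _)))
  let Y : Finset (Fin (n - k)) := Finset.univ.filter fun y => Sum.inr y ∈ b
  let ι : ↥Z ⊕ ↥Y → Fin (k + 1) ⊕ Fin (n - k) := Sum.map Subtype.val Subtype.val
  have hι : Function.Injective ι := Subtype.val_injective.sumMap Subtype.val_injective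
  have hιb : ∀ i, ι i ∈ b := by
    rintro (z | y)
    · exact hbZ ⟨z, z.2, rfl⟩
    · exact (Finset.mem_filter.1 y.2).2
  have hbι : ∀ i ∈ b, ∃ j, ι j = i := by
    intro i hi
    rcases hbt hi with ⟨z, hz, rfl⟩ | ⟨y, rfl⟩
    · exact ⟨.inl ⟨z, hz⟩, rfl⟩
    · exact ⟨.inr ⟨y, Finset.mem_filter.2 ⟨Finset.mem_univ _, hi⟩⟩, rfl⟩
  have himg : q '' b = Set.range (q ∘ ι) := by
    ext x
    constructor
    · rintro ⟨i, hi, rfl⟩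
      obtain ⟨j, rfl⟩ := hbι i hi
      exact ⟨j, rfl⟩
    · rintro ⟨j, rfl⟩
      exact ⟨ι j, hιb j, rfl⟩
  rw [himg] at hspan
  have hinr : ∀ t, q (.inr t) ∈ Submodule.span ℂ (Set.range (q ∘ ι)) := fun t =>
    hspan ⟨_, Or.inr ⟨t, rfl⟩, rfl⟩
  have hall : ∀ i, q i ∈ Submodule.span ℂ (Set.range (q ∘ ι)) := by
    rintro (a | t)
    · have h := hc a
      rw [h]
      exact Submodule.sum_mem _ fun z _ => Submodule.smul_mem _ _
        (Submodule.subset_span ⟨.inl z, rfl⟩)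
    · exact hinr t
  have hcard : Z.card + Y.card = n - k := by
    have htop : ⊤ ≤ Submodule.span ℂ (Set.range (q ∘ ι)) := by
      rw [← Submodule.range_mkQ Λ, ← Submodule.map_top, ← e.span_eq, Submodule.map_span,
        Submodule.span_le]
      rintro _ ⟨_, ⟨i, rfl⟩, rfl⟩
      exact hall i
    have hli' : LinearIndependent ℂ (q ∘ ι) :=
      hli.comp (fun i => (⟨ι i, hιb i⟩ : b)) fun i j h => hι (congrArg Subtype.val h)
    have h1 := Module.finrank_eq_card_basis (Module.Basis.mk hli' htop)
    have h2 := Submodule.finrank_quotient_add_finrank Λ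
    rw [hΛ, h1, Module.finrank_fin_fun, Fintype.card_sum, Fintype.card_coe, Fintype.card_coe] at h2
    omega
  choose c' hc' using fun t : ↥Yᶜ => (Submodule.mem_span_range_iff_exists_fun ℂ).1 (hinr t)
  refine ⟨Z, Y, fun p => c p, c', ?_, hcard, ?_⟩
  · by_contra hempty
    rw [Finset.not_nonempty_iff_eq_empty] at hempty
    subst hempty
    refine hne (Submodule.eq_of_le_of_finrank_eq ?_ (hL.trans hΛ.symm)).symm
    rw [heL, Submodule.span_le]
    rintro _ ⟨a, rfl⟩
    have h := hc a
    simpa [q] using h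
  · rintro (p | t) <;> rw [← Submodule.Quotient.mk_eq_zero, ← Submodule.mkQ_apply]
    · simp only [echelonBasis, map_sub, map_sum, map_smul, sub_eq_zero]
      exact hc p
    · simp only [echelonBasis, map_sub, map_sum, map_smul, sub_eq_zero]
      exact (hc' t).symm

theorem holdsGenerically_unique_plane {n k s : ℕ} {d : Fin s → ℕ} (hd : ∀ i, 2 ≤ d i)
    (hd2 : ¬ (s = 1 ∧ ∀ i, d i = 2))
    (hδ : (k + 1) * (n - k) < ∑ i, (k + 1).multichoose (d i))
    {L : Submodule ℂ (Fin (n + 1) → ℂ)} (hL : IsPlane k L) :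
    HoldsGenerically (formsThrough d L) fun f => ∀ Λ : Submodule ℂ (Fin (n + 1) → ℂ),
      IsPlane k Λ → (∀ i, ∀ x ∈ Λ, eval x (f i) = 0) → Λ = L := by
  classical
  obtain ⟨e, heL, hrepr⟩ := exists_adapted_basis hL
  have key : HoldsGenerically (formsThrough d L) fun f =>
      ∀ ZY : Finset (Fin (k + 1)) × Finset (Fin (n - k)), ZY.1.Nonempty →
        ZY.1.card + ZY.2.card = n - k → ∀ c c',
          ∃ i, aeval (lineSubst (echelonBasis e ZY.1 ZY.2 c c')) (f i) ≠ 0 := by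
    refine HoldsGenerically.forall_finite fun ⟨Z, Y⟩ => ?_
    by_cases hZ : Z.Nonempty
    · by_cases hcard : Z.card + Y.card = n - k
      · exact (holdsGenerically_echelonBasis e Z Y hd hd2 hδ hrepr hZ hcard).mono
          fun f _ hf _ _ => hf
      · exact (holdsGenerically_true _).mono fun f _ _ _ h => absurd h hcard
    · exact (holdsGenerically_true _).mono fun f _ _ h => absurd h hZ
  refine key.mono fun f _ hf Λ hΛ hfΛ => ?_
  by_contra hne
  obtain ⟨Z, Y, c, c', hZ, hcard, hmem⟩ := exists_echelonBasis_mem e hL hΛ hne heL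
  obtain ⟨i, hi⟩ := hf ⟨Z, Y⟩ hZ hcard c c'
  exact hi (aeval_lineSubst_eq_zero _ hmem (hfΛ i))

theorem holdsGenerically_unique_tangent {n k s : ℕ} {d : Fin s → ℕ} (hd : ∀ i, 2 ≤ d i)
    (hd2 : ¬ (s = 1 ∧ ∀ i, d i = 2))
    (hδ : (k + 1) * (n - k) < ∑ i, (k + 1).multichoose (d i))
    {L : Submodule ℂ (Fin (n + 1) → ℂ)} (hL : IsPlane k L) :
    HoldsGenerically (formsThrough d L) fun f => ∀ φ : L →ₗ[ℂ] (Fin (n + 1) → ℂ),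
      (∀ i, ∀ x : L, ∑ j, eval x.1 (pderiv j (f i)) * φ x j = 0) → ∀ x, φ x ∈ L := by
  classical
  obtain ⟨e, heL, hrepr⟩ := exists_adapted_basis hL
  have key : HoldsGenerically (formsThrough d L) fun f =>
      ∀ Z : Finset (Fin (k + 1)), Z.Nonempty → ∀ c r, LinearIndependent ℂ r →
        ∃ i, dirDeriv (kernelBasis e Z c) (kernelValue e Z r) (f i) ≠ 0 := by
    refine HoldsGenerically.forall_finite fun Z => ?_
    by_cases hZ : Z.Nonempty
    · exact (holdsGenerically_dirDeriv e Z hd hd2 hδ hrepr hZ).mono fun f _ hf _ => hf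
    · exact (holdsGenerically_true _).mono fun f _ _ h => absurd h hZ
  have hmemL : ∀ x, (∀ b, e.repr x (.inr b) = 0) → x ∈ L := by
    intro x hx
    rw [← e.sum_repr x, Fintype.sum_sum_type]
    simp only [hx, zero_smul, Finset.sum_const_zero, add_zero]
    rw [heL]
    exact Submodule.sum_mem _ fun a _ => Submodule.smul_mem _ _
      (Submodule.subset_span ⟨a, rfl⟩)
  have heA : ∀ a, e (.inl a) ∈ L := fun a => by
    rw [heL]
    exact Submodule.subset_span ⟨a, rfl⟩
  refine key.mono fun f hfS hf φ hφ => ?_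
  let pr : (Fin (n + 1) → ℂ) →ₗ[ℂ] (Fin (n - k) → ℂ) := LinearMap.pi fun b => e.coord (.inr b)
  have hpr : ∀ x, pr x = 0 → x ∈ L := fun x hx => hmemL x fun b => congrFun hx b
  have hprL : ∀ x ∈ L, pr x = 0 := fun x hx => funext fun b => hrepr x hx b
  -- The columns of φ modulo `L`; a maximal independent set of them is `Z`, which is empty exactly
  -- when φ maps into `L`.
  let v : Fin (k + 1) → Fin (n - k) → ℂ := fun a => pr (φ ⟨e (.inl a), heA a⟩)
  obtain ⟨Z, c, hli, hc⟩ := exists_linearIndependent_finset v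
  by_cases hZ : Z.Nonempty
  · exfalso
    obtain ⟨i, hi⟩ := hf Z hZ (fun p => c p) (fun z => v z) hli
    let α := kernelBasis e Z (fun p => c p)
    let β := kernelValue e Z (fun z => v z)
    have hα : ∀ a, α a ∈ L := by
      intro a
      simp only [α, kernelBasis]
      split_ifs
      · exact heA a
      · exact L.sub_mem (heA a) (L.sum_mem fun z _ => L.smul_mem _ (heA z))
    -- The normalized tangent vector β agrees with φ only modulo `L`, which suffices by
    -- `sum_pderiv_eq_zero_of_mem`.
    have hβ : ∀ a, β a - φ ⟨α a, hα a⟩ ∈ L := by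
      intro a
      apply hpr
      by_cases h : a ∈ Z
      · have h1 : (⟨α a, hα a⟩ : L) = ⟨e (.inl a), heA a⟩ := Subtype.ext (by simp [α, kernelBasis, h])
        rw [h1, map_sub, sub_eq_zero]
        change _ = v a
        funext b
        simp [pr, β, kernelValue, h, Finsupp.single_apply]
      · have h1 : (⟨α a, hα a⟩ : L) = ⟨e (.inl a), heA a⟩ -
            ∑ z : ↥Z, c a z • ⟨e (.inl z), heA z⟩ :=
          Subtype.ext (by simp [α, kernelBasis, h])
        have h2 : β a = 0 := by simp [β, kernelValue, h]
        rw [h1, h2, zero_sub, map_neg, map_sub, map_sub, map_sum, map_sum, neg_eq_zero, sub_eq_zero]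
        simp only [map_smul]
        exact hc a
    apply hi
    refine MvPolynomial.funext fun y => ?_
    have hx : ∑ a, y a • α a ∈ L := L.sum_mem fun a _ => L.smul_mem _ (hα a)
    have hφx : φ ⟨∑ a, y a • α a, hx⟩ = ∑ a, y a • φ ⟨α a, hα a⟩ := by
      have : (⟨∑ a, y a • α a, hx⟩ : L) = ∑ a, y a • ⟨α a, hα a⟩ := Subtype.ext (by simp)
      rw [this, map_sum]
      simp only [map_smul]
    have hl : ∑ a, y a • β a - φ ⟨∑ a, y a • α a, hx⟩ ∈ L := by
      rw [hφx, ← Finset.sum_sub_distrib]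
      simp only [← smul_sub]
      exact L.sum_mem fun a _ => L.smul_mem _ (hβ a)
    have h1 := hφ i ⟨_, hx⟩
    have h2 := sum_pderiv_eq_zero_of_mem (hfS.2 i) hx hl
    simp only [Pi.sub_apply, mul_sub, Finset.sum_sub_distrib] at h2
    rw [h1, sub_zero] at h2
    rw [dirDeriv_apply, map_sum, map_zero, ← h2]
    refine Finset.sum_congr rfl fun j _ => ?_
    rw [map_mul, eval_lineSubst, eval_aeval_lineSubst, mul_comm]
  · intro x
    have hv : ∀ a, v a = 0 := by
      intro a
      rw [Finset.not_nonempty_iff_eq_empty] at hZ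
      subst hZ
      simpa using hc a
    have h1 : ∀ y, ∀ hy : y ∈ L, pr (φ ⟨y, hy⟩) = 0 := by
      intro y hy
      have h2 : y = ∑ a, e.repr y (.inl a) • e (.inl a) := by
        conv_lhs => rw [← e.sum_repr y, Fintype.sum_sum_type]
        simp [hrepr y hy]
      have h3 : (⟨y, hy⟩ : L) = ∑ a, e.repr y (.inl a) • ⟨e (.inl a), heA a⟩ :=
        Subtype.ext (by simpa using h2)
      rw [h3, map_sum, map_sum]
      refine Finset.sum_eq_zero fun a _ => ?_
      rw [map_smul, map_smul]
      exact (congrArg _ (hv a)).trans (smul_zero _)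
    exact hpr _ (h1 x.1 x.2)

/-! ### Charts of the Grassmannian and points in a chart. -/

section Graph

variable {ι R : Type*} [Fintype ι] [DecidableEq ι] [CommRing R] (J : Finset ι)

/-- The graph of the linear map with matrix `a` from the coordinate subspace outside `J` to the
coordinate subspace on `J`. -/
def graphSubmodule (a : ↥Jᶜ → ↥J → R) : Submodule R (ι → R) where
  carrier := {x | ∀ j : ↥J, x j = ∑ l : ↥Jᶜ, x l * a l j}
  add_mem' := by
    intro x y hx hy j
    simp only [Pi.add_apply, add_mul, Finset.sum_add_distrib]
    rw [hx j, hy j]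
  zero_mem' := by
    intro j
    simp
  smul_mem' := by
    intro c x hx j
    simp only [Pi.smul_apply, smul_eq_mul, mul_assoc, ← Finset.mul_sum]
    rw [hx j]

/-- The vector on the graph of `a` over `y`. -/
def graphVec (a : ↥Jᶜ → ↥J → R) (y : ↥Jᶜ → R) (i : ι) : R :=
  if h : i ∈ J then ∑ l, y l * a l ⟨i, h⟩ else y ⟨i, Finset.mem_compl.2 h⟩

variable {J}

theorem mem_graphSubmodule {a : ↥Jᶜ → ↥J → R} {x : ι → R} :
    x ∈ graphSubmodule J a ↔ ∀ j : ↥J, x j = ∑ l : ↥Jᶜ, x l * a l j :=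
  Iff.rfl

theorem graphVec_compl (a : ↥Jᶜ → ↥J → R) (y : ↥Jᶜ → R) (l : ↥Jᶜ) : graphVec J a y l = y l := by
  simp [graphVec, Finset.mem_compl.1 l.2]

theorem graphVec_pivot (a : ↥Jᶜ → ↥J → R) (y : ↥Jᶜ → R) (j : ↥J) :
    graphVec J a y j = ∑ l, y l * a l j := by
  simp [graphVec]

theorem graphVec_mem (a : ↥Jᶜ → ↥J → R) (y : ↥Jᶜ → R) : graphVec J a y ∈ graphSubmodule J a := by
  intro j
  simp only [graphVec_compl, graphVec_pivot]

theorem eq_graphVec {a : ↥Jᶜ → ↥J → R} {x : ι → R} (hx : x ∈ graphSubmodule J a) :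
    x = graphVec J a fun l => x l := by
  funext i
  by_cases h : i ∈ J
  · exact (hx ⟨i, h⟩).trans (graphVec_pivot a _ ⟨i, h⟩).symm
  · exact (graphVec_compl a (fun l => x l) ⟨i, Finset.mem_compl.2 h⟩).symm

theorem graphSubmodule_injective {a a' : ↥Jᶜ → ↥J → R}
    (h : graphSubmodule J a = graphSubmodule J a') : a = a' := by
  funext l j
  have h1 : graphVec J a (Pi.single l 1) ∈ graphSubmodule J a' := h ▸ graphVec_mem a _
  have h2 := h1 j
  simpa [graphVec_pivot, graphVec_compl, Pi.single_apply] using h2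

theorem map_graphVec {S : Type*} [CommRing S] (g : R →+* S) (a : ↥Jᶜ → ↥J → R) (y : ↥Jᶜ → R) :
    (fun i => g (graphVec J a y i)) = graphVec J (fun l j => g (a l j)) fun l => g (y l) := by
  funext i
  by_cases h : i ∈ J <;> simp [graphVec, h]

theorem finrank_graphSubmodule [Nontrivial R] (a : ↥Jᶜ → ↥J → R) :
    Module.finrank R (graphSubmodule J a) = Jᶜ.card := by
  let E : graphSubmodule J a ≃ₗ[R] (↥Jᶜ → R) :=
    { toFun := fun x l => x.1 l
      invFun := fun y => ⟨graphVec J a y, graphVec_mem a y⟩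
      map_add' := fun x y => rfl
      map_smul' := fun c x => rfl
      left_inv := fun x => Subtype.ext (eq_graphVec x.2).symm
      right_inv := fun y => funext fun l => graphVec_compl a y l }
  rw [E.finrank_eq, Module.finrank_fintype_fun_eq_card, Fintype.card_coe]

theorem aeval_aeval_graphVec {S : Type*} [CommRing S] [Algebra ℂ S] (b : ↥Jᶜ → ↥J → S)
    (y : ↥Jᶜ → ℂ) (g : MvPolynomial ι ℂ) :
    aeval (fun q : ↥Jᶜ × ↥J => b q.1 q.2)
      (aeval (graphVec J (fun l j => (X (l, j) : MvPolynomial (↥Jᶜ × ↥J) ℂ)) fun l => C (y l)) g) =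
      aeval (graphVec J b fun l => algebraMap ℂ S (y l)) g := by
  rw [comp_aeval_apply]
  have h := map_graphVec (J := J) (aeval (R := ℂ) fun q : ↥Jᶜ × ↥J => b q.1 q.2).toRingHom
    (fun l j => X (l, j)) fun l => C (y l)
  simp only [AlgHom.toRingHom_eq_coe, RingHom.coe_coe, aeval_X, aeval_C] at h
  rw [h]

end Graph

theorem graphSubmodule_map_eq_extendScalars {n : ℕ} {J : Finset (Fin (n + 1))}
    (a : ↥Jᶜ → ↥J → ℂ) (R : Type u) [CommRing R] [Algebra ℂ R] :
    graphSubmodule J (fun l j => algebraMap ℂ R (a l j)) =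
      extendScalars (graphSubmodule J a) R := by
  apply le_antisymm
  · intro x hx
    have h : x = ∑ l : ↥Jᶜ, x l • fun i => algebraMap ℂ R (graphVec J a (Pi.single l 1) i) := by
      funext i
      rw [Finset.sum_apply]
      simp only [Pi.smul_apply, smul_eq_mul]
      conv_lhs => rw [eq_graphVec hx]
      by_cases h : i ∈ J
      · simp [graphVec, h, Pi.single_apply]
      · rw [Finset.sum_eq_single ⟨i, Finset.mem_compl.2 h⟩]
        · simp [graphVec, h]
        · intro l _ hl
          simp [graphVec, h, Pi.single_eq_of_ne hl.symm]
        · simp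
    rw [h]
    exact Submodule.sum_mem _ fun l _ => Submodule.smul_mem _ _
      (Submodule.subset_span ⟨_, graphVec_mem a _, rfl⟩)
  · rw [extendScalars, Submodule.span_le]
    rintro _ ⟨x, hx, rfl⟩ j
    simp only [← map_mul, ← map_sum]
    rw [hx j]

theorem Ideal.eq_bot_of_isNilpotent_of_le_sq {R : Type*} [CommRing R] {N : Ideal R}
    (h : IsNilpotent N) (h2 : N ≤ N ^ 2) : N = ⊥ := by
  obtain ⟨m, hm⟩ := h
  have : ∀ m, N ≤ N ^ (m + 1) := by
    intro m
    induction m with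
    | zero => simp
    | succ m ih =>
      calc N ≤ N * N := by rwa [← pow_two]
        _ ≤ N ^ (m + 1) * N := Ideal.mul_mono_left ih
        _ = N ^ (m + 1 + 1) := (pow_succ _ _).symm
  rw [eq_bot_iff, ← Ideal.zero_eq_bot, ← hm]
  rcases m with _ | m
  · simp
  · exact this m

/-- Over a nontrivial ring, a point of the Fano scheme in a standard chart of the Grassmannian is
constant, if `L` is the only complex point and has no tangent vectors. -/
theorem graphSubmodule_eq_extendScalars {n k s : ℕ} {d : Fin s → ℕ}
    {L : Submodule ℂ (Fin (n + 1) → ℂ)} {f : Fin s → MvPolynomial (Fin (n + 1)) ℂ}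
    (hf : f ∈ formsThrough d L)
    (hplane : ∀ Λ : Submodule ℂ (Fin (n + 1) → ℂ),
      IsPlane k Λ → (∀ i, ∀ x ∈ Λ, eval x (f i) = 0) → Λ = L)
    (htangent : ∀ φ : L →ₗ[ℂ] (Fin (n + 1) → ℂ),
      (∀ i, ∀ x : L, ∑ j, eval x.1 (pderiv j (f i)) * φ x j = 0) → ∀ x, φ x ∈ L)
    {J : Finset (Fin (n + 1))} (hJ : Jᶜ.card = k + 1) {R : Type u} [CommRing R] [Nontrivial R]
    [Algebra ℂ R] (a : ↥Jᶜ → ↥J → R)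
    (ha : ∀ i, ∀ x ∈ graphSubmodule J a, aeval x (f i) = 0) :
    graphSubmodule J a = extendScalars L R := by
  -- Equations of the Fano scheme in the chart. Testing on complex vectors suffices to determine its
  -- complex points, and `a` satisfies these equations as well.
  let F : Fin s × (↥Jᶜ → ℂ) → MvPolynomial (↥Jᶜ × ↥J) ℂ := fun p =>
    aeval (graphVec J (fun l j => X (l, j)) fun l => C (p.2 l)) (f p.1)
  let I : Ideal (MvPolynomial (↥Jᶜ × ↥J) ℂ) := Ideal.span (Set.range F)
  have hIa : ∀ g ∈ I, aeval (fun q : ↥Jᶜ × ↥J => a q.1 q.2) g = 0 := by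
    have : I ≤ RingHom.ker (aeval (R := ℂ) fun q : ↥Jᶜ × ↥J => a q.1 q.2) := by
      rw [Ideal.span_le]
      rintro _ ⟨p, rfl⟩
      exact (aeval_aeval_graphVec a p.2 (f p.1)).trans (ha _ _ (graphVec_mem _ _))
    exact this
  have hzero : ∀ b ∈ zeroLocus ℂ I, graphSubmodule J (fun l j => b (l, j)) = L := by
    intro b hb
    refine hplane _ ((finrank_graphSubmodule _).trans hJ) fun i x hx => ?_
    have h1 := hb (F (i, fun l => x l)) (Ideal.subset_span ⟨_, rfl⟩)
    rw [eq_graphVec hx]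
    exact (aeval_aeval_graphVec (fun l j => b (l, j)) (fun l => x l) (f i)).symm.trans h1
  -- Otherwise 1 ∈ I by the Nullstellensatz, and evaluation at `a` gives 1 = 0 in `R`.
  obtain ⟨b, hb⟩ : (zeroLocus ℂ I).Nonempty := by
    by_contra hne
    rw [Set.not_nonempty_iff_eq_empty] at hne
    have h1 := vanishingIdeal_zeroLocus_eq_radical (K := ℂ) I
    have h2 : (1 : MvPolynomial (↥Jᶜ × ↥J) ℂ) ∈ I.radical := by
      rw [← h1, mem_vanishingIdeal_iff, hne]
      simp
    obtain ⟨m, hm⟩ := h2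
    rw [one_pow] at hm
    have h3 := hIa 1 hm
    rw [map_one] at h3
    exact one_ne_zero h3
  let a₀ : ↥Jᶜ → ↥J → ℂ := fun l j => b (l, j)
  have ha₀ : graphSubmodule J a₀ = L := hzero b hb
  have hnil : ∀ q : ↥Jᶜ × ↥J, IsNilpotent (a q.1 q.2 - algebraMap ℂ R (a₀ q.1 q.2)) := by
    intro q
    -- All complex zeros of `I` equal `a₀`, so this difference vanishes on the zero locus.
    have h1 : X q - C (a₀ q.1 q.2) ∈ I.radical := by
      rw [← vanishingIdeal_zeroLocus_eq_radical (K := ℂ) I, mem_vanishingIdeal_iff]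
      intro b' hb'
      have h2 := graphSubmodule_injective ((hzero b' hb').trans ha₀.symm)
      have h3 := congrFun (congrFun h2 q.1) q.2
      simp only [map_sub, aeval_X, aeval_C, sub_eq_zero]
      exact h3
    obtain ⟨m, hm⟩ := h1
    refine ⟨m, ?_⟩
    have h2 := hIa _ hm
    simpa using h2
  let δ : ↥Jᶜ × ↥J → R := fun q => a q.1 q.2 - algebraMap ℂ R (a₀ q.1 q.2)
  let N : Ideal R := Ideal.span (Set.range δ)
  have hδN : ∀ q, δ q ∈ N := fun q => Ideal.subset_span ⟨q, rfl⟩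
  have hNnil : IsNilpotent N := by
    rw [Ideal.FG.isNilpotent_iff_le_nilradical (Submodule.fg_span (Set.finite_range δ)), Ideal.span_le]
    rintro _ ⟨q, rfl⟩
    exact hnil q
  have hN2 : N ≤ N ^ 2 := by
    rw [Ideal.span_le]
    rintro _ ⟨q, rfl⟩
    rw [SetLike.mem_coe, ← Ideal.Quotient.eq_zero_iff_mem,
      ← Module.forall_dual_apply_eq_zero_iff ℂ]
    -- A ℂ-linear functional on R/N² turns the perturbation δ into a complex tangent vector ψ at
    -- `L`: modulo N² the equations at `a` are linear in δ.
    intro ξ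
    let Ξ : ↥Jᶜ → ↥J → ℂ := fun l j => ξ (Ideal.Quotient.mk (N ^ 2) (δ (l, j)))
    let ψ : (Fin (n + 1) → ℂ) →ₗ[ℂ] (Fin (n + 1) → ℂ) :=
      { toFun := fun x i => if h : i ∈ J then ∑ l : ↥Jᶜ, x l * Ξ l ⟨i, h⟩ else 0
        map_add' := by
          intro x y
          funext i
          by_cases h : i ∈ J <;> simp [h, add_mul, Finset.sum_add_distrib]
        map_smul' := by
          intro c x
          funext i
          by_cases h : i ∈ J <;> simp [h, Finset.mul_sum, mul_assoc] }
    have hψL := htangent (ψ ∘ₗ L.subtype) fun i x => by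
      let v : Fin (n + 1) → R := fun t => algebraMap ℂ R (x.1 t)
      let η : Fin (n + 1) → R := fun t =>
        if h : t ∈ J then ∑ l : ↥Jᶜ, algebraMap ℂ R (x.1 l) * δ (l, ⟨t, h⟩) else 0
      have hη : ∀ t, η t ∈ N := by
        intro t
        simp only [η]
        split_ifs
        · exact N.sum_mem fun l _ => N.mul_mem_left _ (hδN _)
        · exact N.zero_mem
      have hxL : x.1 ∈ graphSubmodule J a₀ := ha₀ ▸ x.2
      have hvη : v + η ∈ graphSubmodule J a := by
        intro j
        have h1 : ∀ l : ↥Jᶜ, (v + η) l = algebraMap ℂ R (x.1 l) := by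
          intro l
          simp [v, η, Finset.mem_compl.1 l.2]
        simp only [h1]
        simp [v, η, hxL j, δ, mul_sub]
      have h1 := aeval_add_sub_mem_sq N v η hη (f i)
      have h2 : ∀ g : MvPolynomial (Fin (n + 1)) ℂ, aeval v g = algebraMap ℂ R (eval x.1 g) :=
        fun g => (comp_aeval_apply (R := ℂ) x.1 (Algebra.ofId ℂ R) g).symm
      rw [ha i _ hvη, h2, hf.2 i x.1 x.2, map_zero, sub_zero, zero_sub, neg_mem_iff,
        ← Ideal.Quotient.eq_zero_iff_mem] at h1
      have h3 := congrArg ξ h1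
      rw [map_zero, map_sum, map_sum] at h3
      rw [← h3]
      have h4 : ∀ (c : ℂ) (r : R), ξ (Ideal.Quotient.mk (N ^ 2) (algebraMap ℂ R c * r)) =
          c * ξ (Ideal.Quotient.mk (N ^ 2) r) := by
        intro c r
        rw [← Algebra.smul_def, ← smul_eq_mul, ← map_smul]
        rfl
      refine Finset.sum_congr rfl fun t _ => ?_
      rw [h2, h4]
      congr 1
      simp only [ψ, η, LinearMap.comp_apply, LinearMap.coe_mk, AddHom.coe_mk, Submodule.subtype_apply]
      split_ifs with h
      · rw [map_sum, map_sum]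
        exact Finset.sum_congr rfl fun l _ => (h4 _ _).symm
      · simp
    -- ψ takes values in the coordinate subspace on `J`, which meets the graph `L` only in 0; hence
    -- ξ kills δ.
    have h5 : ψ (graphVec J a₀ (Pi.single q.1 1)) ∈ graphSubmodule J a₀ := by
      rw [ha₀]
      exact hψL ⟨graphVec J a₀ (Pi.single q.1 1), ha₀ ▸ graphVec_mem a₀ _⟩
    have h6 := h5 q.2
    have h7 : ∀ l : ↥Jᶜ, (l : Fin (n + 1)) ∉ J := fun l => Finset.mem_compl.1 l.2
    simpa [ψ, graphVec_compl, h7, Pi.single_apply, Ξ] using h6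
  have hN : N = ⊥ := Ideal.eq_bot_of_isNilpotent_of_le_sq hNnil hN2
  have haa : a = fun l j => algebraMap ℂ R (a₀ l j) := by
    funext l j
    have h1 := hδN (l, j)
    rw [hN, Ideal.mem_bot] at h1
    exact sub_eq_zero.1 h1
  rw [haa, graphSubmodule_map_eq_extendScalars, ha₀]

/-! ### From charts to local rings to arbitrary algebras. -/

/-- Over a local ring, `L` is the only point of the Fano scheme, if it is the only complex point and
has no tangent vectors. -/
theorem ker_eq_extendScalars_of_isLocalRing {n k s : ℕ} {d : Fin s → ℕ}
    {L : Submodule ℂ (Fin (n + 1) → ℂ)} {f : Fin s → MvPolynomial (Fin (n + 1)) ℂ}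
    (hk : k ≤ n) (hf : f ∈ formsThrough d L)
    (hplane : ∀ Λ : Submodule ℂ (Fin (n + 1) → ℂ),
      IsPlane k Λ → (∀ i, ∀ x ∈ Λ, eval x (f i) = 0) → Λ = L)
    (htangent : ∀ φ : L →ₗ[ℂ] (Fin (n + 1) → ℂ),
      (∀ i, ∀ x : L, ∑ j, eval x.1 (pderiv j (f i)) * φ x j = 0) → ∀ x, φ x ∈ L)
    {R : Type u} [CommRing R] [IsLocalRing R] [Algebra ℂ R] {Q : Type*} [AddCommGroup Q]
    [Module R Q] [Module.FinitePresentation R Q] [Module.Flat R Q]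
    (hQ : Module.finrank R Q = n - k) (q : Fin (n + 1) → Q)
    (hq : Submodule.span R (Set.range q) = ⊤)
    (hker : ∀ i, ∀ x : Fin (n + 1) → R, ∑ j, x j • q j = 0 → aeval x (f i) = 0)
    (x : Fin (n + 1) → R) : ∑ j, x j • q j = 0 ↔ x ∈ extendScalars L R := by
  classical
  -- Over a local ring a basis of `Q` can be chosen among the spanning vectors `q j`; its index set
  -- `J` is the chart containing the point.
  obtain ⟨κ, g, b, hb⟩ := Module.exists_basis_of_span_of_flat (R := R) (M := Q)
    (ι := ULift.{u} (Fin (n + 1))) (fun i => q i.down) (by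
      rw [← hq]
      congr 1
      exact ULift.down_surjective.range_comp q)
  have hg : Function.Injective fun t => (g t).down := by
    intro t t' h
    refine b.injective ?_
    rw [hb, hb]
    exact congrArg q h
  have : Finite κ := Finite.of_injective _ hg
  have := Fintype.ofFinite κ
  let J : Finset (Fin (n + 1)) := Finset.univ.image fun t => (g t).down
  have hJ : J.card = n - k := by
    rw [Finset.card_image_of_injective _ hg, Finset.card_univ, ← hQ,
      Module.finrank_eq_card_basis b]
  have hJc : Jᶜ.card = k + 1 := by
    rw [Finset.card_compl, hJ, Fintype.card_fin]
    omega
  let E : κ ≃ ↥J := Equiv.ofBijective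
    (fun t => ⟨(g t).down, Finset.mem_image_of_mem _ (Finset.mem_univ t)⟩)
    ⟨fun t t' h => hg (congrArg Subtype.val h), fun j => by
      obtain ⟨t, -, ht⟩ := Finset.mem_image.1 j.2
      exact ⟨t, Subtype.ext ht⟩⟩
  let b' : Module.Basis ↥J R Q := b.reindex E
  have hb' : ∀ j, b' j = q j := by
    intro j
    obtain ⟨t, rfl⟩ := E.surjective j
    rw [Module.Basis.reindex_apply, Equiv.symm_apply_apply, hb]
    rfl
  let a : ↥Jᶜ → ↥J → R := fun l j => -b'.repr (q l) j
  have hmem : ∀ x : Fin (n + 1) → R, ∑ j, x j • q j = 0 ↔ x ∈ graphSubmodule J a := by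
    intro x
    have h1 : ∑ i, x i • q i = ∑ j : ↥J, (x j - ∑ l : ↥Jᶜ, x l * a l j) • b' j := by
      have h2 : ∑ i, x i • q i = ∑ j : ↥J, x j • q j + ∑ l : ↥Jᶜ, x l • q l := by
        rw [← Finset.sum_add_sum_compl J, Finset.sum_coe_sort J fun i => x i • q i,
          Finset.sum_coe_sort Jᶜ fun i => x i • q i]
      have h3 : ∀ l : ↥Jᶜ, x l • q l = -∑ j : ↥J, (x l * a l j) • b' j := by
        intro l
        conv_lhs => rw [← b'.sum_repr (q l)]
        rw [Finset.smul_sum, ← Finset.sum_neg_distrib]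
        refine Finset.sum_congr rfl fun j _ => ?_
        simp [a, mul_smul]
      rw [h2]
      simp only [h3, sub_smul, Finset.sum_sub_distrib, Finset.sum_smul, Finset.sum_neg_distrib]
      rw [Finset.sum_comm, ← sub_eq_add_neg]
      simp only [hb']
    rw [h1, mem_graphSubmodule]
    constructor
    · intro h j
      exact sub_eq_zero.1 (Fintype.linearIndependent_iff.1 b'.linearIndependent _ h j)
    · intro h
      refine Finset.sum_eq_zero fun j _ => ?_
      rw [← h j, sub_self, zero_smul]
  rw [hmem, graphSubmodule_eq_extendScalars hf hplane htangent hJc a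
    fun i x hx => hker i x ((hmem x).2 hx)]

/-- Linear equations for `L` over ℂ, with a splitting, still cut out its scalar extension over every
`R`: on the kernel of P the identity equals 1 - SP, whose columns lie in `L`. Membership thus
becomes a vanishing statement that can be checked locally. -/
theorem exists_matrix_extendScalars {n k : ℕ} {L : Submodule ℂ (Fin (n + 1) → ℂ)}
    (hL : IsPlane k L) : ∃ (P : Matrix (Fin (n - k)) (Fin (n + 1)) ℂ)
      (S : Matrix (Fin (n + 1)) (Fin (n - k)) ℂ), P * S = 1 ∧
      ∀ (R : Type u) [CommRing R] [Algebra ℂ R] (x : Fin (n + 1) → R),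
        x ∈ extendScalars L R ↔ (P.map (algebraMap ℂ R)).mulVec x = 0 := by
  obtain ⟨e, heL, hrepr⟩ := exists_adapted_basis hL
  let P : Matrix (Fin (n - k)) (Fin (n + 1)) ℂ :=
    Matrix.of fun b j => e.repr (Pi.single j 1) (.inr b)
  let S : Matrix (Fin (n + 1)) (Fin (n - k)) ℂ := Matrix.of fun j b => e (.inr b) j
  have hP : ∀ x, P.mulVec x = fun b => e.repr x (.inr b) := by
    intro x
    funext b
    exact (apply_eq_sum_single (e.coord (.inr b)) x).symm
  have hPS : P * S = 1 := by
    ext b b'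
    have h := congrFun (hP (e (.inr b'))) b
    have h2 : (P * S) b b' = P.mulVec (e (.inr b')) b := rfl
    rw [h2, h, e.repr_self, Finsupp.single_apply, Matrix.one_apply]
    simp [eq_comm]
  have hmem : ∀ x, P.mulVec x = 0 → x ∈ L := by
    intro x hx
    rw [hP] at hx
    have hx' : ∀ b, e.repr x (.inr b) = 0 := fun b => congrFun hx b
    rw [← e.sum_repr x, Fintype.sum_sum_type]
    simp only [hx', zero_smul, Finset.sum_const_zero, add_zero]
    rw [heL]
    exact Submodule.sum_mem _ fun a _ => Submodule.smul_mem _ _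
      (Submodule.subset_span ⟨a, rfl⟩)
  refine ⟨P, S, hPS, fun R _ _ x => ⟨fun hx => ?_, fun hx => ?_⟩⟩
  · have h : extendScalars L R ≤ LinearMap.ker (P.map (algebraMap ℂ R)).mulVecLin := by
      rw [extendScalars, Submodule.span_le]
      rintro _ ⟨y, hy, rfl⟩
      have h1 : P.mulVec y = 0 := by
        rw [hP]
        funext b
        exact hrepr y hy b
      rw [SetLike.mem_coe, LinearMap.mem_ker, Matrix.mulVecLin_apply]
      funext b
      have h2 := congrArg (algebraMap ℂ R) (congrFun h1 b)
      simpa [Matrix.mulVec, dotProduct] using h2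
    exact h hx
  · let T := 1 - S * P
    have hT : ∀ j, (fun i => T i j) ∈ L := by
      intro j
      apply hmem
      have h1 : P * T = 0 := by
        rw [Matrix.mul_sub, Matrix.mul_one, ← Matrix.mul_assoc, hPS, Matrix.one_mul, sub_self]
      funext b
      exact congrFun (congrFun h1 b) j
    have h2 : x = (T.map (algebraMap ℂ R)).mulVec x := by
      have h3 : T.map (algebraMap ℂ R) = 1 - S.map (algebraMap ℂ R) * P.map (algebraMap ℂ R) := by
        rw [← Matrix.map_mul, Matrix.map_sub _ (map_sub _), Matrix.map_one _ (map_zero _) (map_one _)]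
      rw [h3, Matrix.sub_mulVec, Matrix.one_mulVec, ← Matrix.mulVec_mulVec, hx, Matrix.mulVec_zero,
        sub_zero]
    have h4 : x = ∑ j, x j • fun i => algebraMap ℂ R (T i j) := by
      conv_lhs => rw [h2]
      funext i
      simp [Matrix.mulVec, dotProduct, Finset.sum_apply, mul_comm]
    rw [h4]
    exact Submodule.sum_mem _ fun j _ => Submodule.smul_mem _ _
      (Submodule.subset_span ⟨_, hT j, rfl⟩)

theorem exists_grassmannian_eq_extendScalars {n k : ℕ} {L : Submodule ℂ (Fin (n + 1) → ℂ)}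
    (hL : IsPlane k L) (R : Type u) [CommRing R] [Algebra ℂ R] :
    ∃ M : Module.Grassmannian R (Fin (n + 1) → R) (n - k), M.toSubmodule = extendScalars L R := by
  obtain ⟨P, S, hPS, hmem⟩ := exists_matrix_extendScalars.{u} hL
  have hker : LinearMap.ker (P.map (algebraMap ℂ R)).mulVecLin = extendScalars L R := by
    ext x
    exact (hmem R x).symm
  have hsurj : Function.Surjective (P.map (algebraMap ℂ R)).mulVecLin := by
    intro y
    refine ⟨(S.map (algebraMap ℂ R)).mulVec y, ?_⟩
    rw [Matrix.mulVecLin_apply, Matrix.mulVec_mulVec, ← Matrix.map_mul, hPS,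
      Matrix.map_one _ (map_zero _) (map_one _), Matrix.one_mulVec]
  rw [← hker]
  have E := (P.map (algebraMap ℂ R)).mulVecLin.quotKerEquivOfSurjective hsurj
  refine ⟨⟨_, Module.Finite.equiv E.symm, Module.Projective.of_equiv E.symm, fun p => ?_⟩, rfl⟩
  have := p.nontrivial
  rw [Module.rankAtStalk_eq_of_equiv E, Module.rankAtStalk_eq_finrank_of_free]
  simp

theorem fanoSchemeEqPoint_of_forall {n k s : ℕ} {d : Fin s → ℕ}
    {L : Submodule ℂ (Fin (n + 1) → ℂ)} (hL : IsPlane k L)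
    {f : Fin s → MvPolynomial (Fin (n + 1)) ℂ} (hf : f ∈ formsThrough d L)
    (hplane : ∀ Λ : Submodule ℂ (Fin (n + 1) → ℂ),
      IsPlane k Λ → (∀ i, ∀ x ∈ Λ, eval x (f i) = 0) → Λ = L)
    (htangent : ∀ φ : L →ₗ[ℂ] (Fin (n + 1) → ℂ),
      (∀ i, ∀ x : L, ∑ j, eval x.1 (pderiv j (f i)) * φ x j = 0) → ∀ x, φ x ∈ L) :
    FanoSchemeEqPoint.{u} k f L := by
  classical
  have hk : k ≤ n := by
    have h := Submodule.finrank_le L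
    rw [hL, Module.finrank_fin_fun] at h
    omega
  intro R _ _
  refine Set.Subset.antisymm ?_ ?_
  swap
  · rintro _ rfl
    obtain ⟨M, hM⟩ := exists_grassmannian_eq_extendScalars hL R
    refine ⟨M, fun i x hx => ?_, hM⟩
    rw [hM] at hx
    exact aeval_eq_zero_of_mem_extendScalars (hf.2 i) hx
  rintro _ ⟨M, hM, rfl⟩
  rw [Set.mem_singleton_iff]
  let Q := (Fin (n + 1) → R) ⧸ M.toSubmodule
  let q : Fin (n + 1) → Q := fun j => M.toSubmodule.mkQ (Pi.single j 1)
  have hq : ∀ x : Fin (n + 1) → R, M.toSubmodule.mkQ x = ∑ j, x j • q j := by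
    intro x
    conv_lhs => rw [pi_eq_sum_univ' x]
    rw [map_sum]
    refine Finset.sum_congr rfl fun j _ => ?_
    rw [map_smul]
  have hlocal : ∀ (p : Ideal R) [p.IsPrime] (x : Fin (n + 1) → Localization.AtPrime p),
      ∑ j, x j • LocalizedModule.mkLinearMap p.primeCompl Q (q j) = 0 ↔
        x ∈ extendScalars L (Localization.AtPrime p) := by
    intro p _
    have hrank : Module.finrank (Localization.AtPrime p) (LocalizedModule p.primeCompl Q) =
      n - k := M.rankAtStalk_eq ⟨p, inferInstance⟩
    have : Module.Finite (Localization.AtPrime p) (LocalizedModule p.primeCompl Q) :=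
      Module.Finite.of_isLocalizedModule p.primeCompl (LocalizedModule.mkLinearMap p.primeCompl Q)
    have : Module.Projective (Localization.AtPrime p) (LocalizedModule p.primeCompl Q) :=
      Module.projective_of_isLocalizedModule p.primeCompl
        (LocalizedModule.mkLinearMap p.primeCompl Q)
    have : Module.FinitePresentation (Localization.AtPrime p) (LocalizedModule p.primeCompl Q) :=
      Module.finitePresentation_of_projective _ _
    refine ker_eq_extendScalars_of_isLocalRing hk hf hplane htangent hrank _ ?_ ?_
    · have h1 : Submodule.span R (Set.range q) = ⊤ := by
        rw [eq_top_iff]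
        rintro y -
        obtain ⟨x, rfl⟩ := M.toSubmodule.mkQ_surjective y
        rw [hq]
        exact Submodule.sum_mem _ fun j _ => Submodule.smul_mem _ _
          (Submodule.subset_span ⟨j, rfl⟩)
      have h2 := span_eq_top_of_isLocalizedModule (Localization.AtPrime p) p.primeCompl
        (LocalizedModule.mkLinearMap p.primeCompl Q) h1
      rw [← h2, ← Set.range_comp]
      rfl
    · intro i x hx
      -- The hypothesis on `M` concerns vectors over `R`, so clear denominators until a multiple of
      -- `x` comes from `M`. By homogeneity the forms change by a power of a unit.
      obtain ⟨c, hc⟩ := IsLocalization.exist_integer_multiples_of_finite p.primeCompl x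
      choose y hy using hc
      have h1 : LocalizedModule.mkLinearMap p.primeCompl Q (M.toSubmodule.mkQ y) = 0 := by
        have h2 : ∀ j, LocalizedModule.mkLinearMap p.primeCompl Q (y j • q j) =
            (c : R) • (x j • LocalizedModule.mkLinearMap p.primeCompl Q (q j)) := by
          intro j
          rw [map_smul, ← smul_assoc, ← hy j, algebraMap_smul]
        rw [hq, map_sum]
        simp only [h2]
        rw [← Finset.smul_sum, hx, smul_zero]
      obtain ⟨t, ht⟩ := (IsLocalizedModule.eq_zero_iff p.primeCompl _).1 h1
      have h3 : (t : R) • y ∈ M.toSubmodule := by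
        rw [← Submodule.Quotient.mk_eq_zero, ← Submodule.mkQ_apply, map_smul]
        exact ht
      have h4 := congrArg (algebraMap R (Localization.AtPrime p)) (hM i _ h3)
      have h5 : algebraMap R (Localization.AtPrime p) (aeval ((t : R) • y) (f i)) =
          aeval (algebraMap R (Localization.AtPrime p) (t * c) • x) (f i) := by
        have h6 := comp_aeval_apply (R := ℂ) ((t : R) • y)
          (IsScalarTower.toAlgHom ℂ R (Localization.AtPrime p)) (f i)
        refine h6.trans ?_
        congr 2
        funext j
        simp only [IsScalarTower.coe_toAlgHom', Pi.smul_apply, smul_eq_mul, map_mul, hy j]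
        rw [Algebra.smul_def, mul_assoc]
      rw [h5, map_zero, (hf.1 i).aeval_smul] at h4
      have h7 : IsUnit (algebraMap R (Localization.AtPrime p) (t * c)) :=
        IsLocalization.map_units (Localization.AtPrime p) (t * c)
      exact (h7.pow _).mul_right_eq_zero.1 h4
  obtain ⟨P, S, hPS, hmem⟩ := exists_matrix_extendScalars.{u} hL
  -- Both inclusions are checked locally: one through the equations P of `L`, the other in the
  -- quotient by `M`.
  apply le_antisymm
  · intro x hx
    rw [hmem]
    funext b
    refine eq_zero_of_localization _ fun p hp => ?_
    have h1 : (fun j => algebraMap R (Localization.AtPrime p) (x j)) ∈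
        extendScalars L (Localization.AtPrime p) := by
      rw [← hlocal p]
      have h2 : M.toSubmodule.mkQ x = 0 := by
        rwa [Submodule.mkQ_apply, Submodule.Quotient.mk_eq_zero]
      rw [hq] at h2
      have h3 := congrArg (LocalizedModule.mkLinearMap p.primeCompl Q) h2
      rw [map_sum, map_zero] at h3
      rw [← h3]
      refine Finset.sum_congr rfl fun j _ => ?_
      rw [map_smul, algebraMap_smul]
    rw [hmem] at h1
    have h2 := congrFun h1 b
    simp only [Matrix.mulVec, dotProduct, Matrix.map_apply, map_sum, map_mul, Pi.zero_apply] at h2 ⊢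
    rw [← h2]
    refine Finset.sum_congr rfl fun j _ => ?_
    rw [← IsScalarTower.algebraMap_apply]
  · rw [extendScalars, Submodule.span_le]
    rintro _ ⟨x, hx, rfl⟩
    rw [SetLike.mem_coe, ← Submodule.Quotient.mk_eq_zero, ← Submodule.mkQ_apply]
    refine Module.eq_zero_of_localization_maximal
      (fun (p : Ideal R) _ => LocalizedModule p.primeCompl Q)
      (fun (p : Ideal R) _ => LocalizedModule.mkLinearMap p.primeCompl Q)
      (M.toSubmodule.mkQ fun j => algebraMap ℂ R (x j)) fun p hp => ?_
    rw [hq, map_sum]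
    have h1 : (fun j => algebraMap ℂ (Localization.AtPrime p) (x j)) ∈
        extendScalars L (Localization.AtPrime p) := Submodule.subset_span ⟨x, hx, rfl⟩
    rw [← hlocal p] at h1
    rw [← h1]
    refine Finset.sum_congr rfl fun j _ => ?_
    rw [map_smul, IsScalarTower.algebraMap_apply ℂ R (Localization.AtPrime p)]
    exact (algebraMap_smul (Localization.AtPrime p) (algebraMap ℂ R (x j)) _).symm

theorem theorem2p3 (n k s : ℕ) (d : Fin s → ℕ) (hd : ∀ i, 2 ≤ d i)
    (hd2 : ¬ (s = 1 ∧ ∀ i, d i = 2)) (hδ : expectedDim n d k < 0)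
    (L : Submodule ℂ (Fin (n + 1) → ℂ)) (hL : IsPlane k L) :
    HoldsGenerically (formsThrough d L) (fun f => FanoSchemeEqPoint.{u} k f L) := by
  have hk : k ≤ n := by
    have h := Submodule.finrank_le L
    rw [hL, Module.finrank_fin_fun] at h
    omega
  -- C(d+k, k) counts the monomials of degree d in k+1 variables; `hk` makes the truncated
  -- subtraction harmless.
  have hδ' : (k + 1) * (n - k) < ∑ i, (k + 1).multichoose (d i) := by
    have h1 : ∀ i, (k + 1).multichoose (d i) = (d i + k).choose k := by
      intro i
      rw [Nat.multichoose_eq, show k + 1 + d i - 1 = d i + k by omega, Nat.choose_symm_add]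
    simp only [h1]
    zify [hk]
    simp only [expectedDim] at hδ
    linarith
  exact ((holdsGenerically_unique_plane hd hd2 hδ' hL).and
    (holdsGenerically_unique_tangent hd hd2 hδ' hL)).mono fun f hf h =>
      fanoSchemeEqPoint_of_forall hL hf h.1 h.2
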